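/- A \emph{graph class} is a nonempty, isomorphism-closed collection of finite simple graphs (where nonemptiness means that it contains a graph with at least one vertex); it is \emph{hereditary} if $G \in \mathcal{P}$ implies $G[U] \in \mathcal{P}$ for every nonempty $U \subseteq V(G)$. The \emph{maximal connected induced $\mathcal{P}$ subgraphs problem} asks, given a finite simple graph $G$ on $n$ vertices, to output exactly once each of the $N$ inclusion-maximal elements (the \emph{solutions}) of the family of all nonempty $U \subseteq V(G)$ such that $G[U]$ is connected and $G[U] \in \mathcal{P}$. An algorithm is a deterministic program of the WHILE language on binary trees with unit-cost elementary steps (a machine model polynomial-time equivalent to Turing machines), extended by an output instruction; the input is the adjacency matrix of $G$, and vertex sets are output as characteristic vectors. The problem \emph{can be solved in polynomial total time} if there are an algorithm and a polynomial $p$ such that on every input the algorithm outputs all solutions and halts within $p(n, N)$ steps. It \emph{can be solved in incremental polynomial time} if there are an algorithm and a polynomial $p$ such that on every input the algorithm outputs all solutions and halts, and, for every $1 \le s \le N$, the $s$-th solution is output within the first $p(n, s)$ steps. \textbf{Theorem.} For every hereditary graph class $\mathcal{P}$, the maximal connected induced $\mathcal{P}$ subgraphs problem can be solved in polynomial total time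 if and only if it can be solved in incremental polynomial time. -/

import Mathlib

/-! ### Graph classes and maximal connected induced subgraphs -/

/-- A graph class: a nonempty collection of finite simple graphs, closed under isomorphism.
Graphs of the class are looked for among those with at least one vertex; whether the graph
without vertices belongs to the class is irrelevant. -/
structure GraphClass where
  Mem : ∀ {V : Type} [Finite V], SimpleGraph V → Prop
  iso_closed : ∀ {V W : Type} [Finite V] [Finite W] {G : SimpleGraph V} {H : SimpleGraph W},
    Nonempty (G ≃g H) → Mem G → Mem H
  nonempty : ∃ (n : ℕ) (G : SimpleGraph (Fin n)), 0 < n ∧ Mem G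

/-- A graph class is hereditary if `G[U]` is in the class whenever `G` is and `U` is a nonempty
set of vertices of `G`. -/
def GraphClass.Hereditary (P : GraphClass) : Prop :=
  ∀ {V : Type} [Finite V] (G : SimpleGraph V), P.Mem G →
    ∀ U : Set V, U.Nonempty → P.Mem (G.induce U)

/-- `U` is a connected `P` set of `G`: `G[U]` is connected (so `U` is nonempty) and in `P`. -/
def IsConnectedPSet (P : GraphClass) {n : ℕ} (G : SimpleGraph (Fin n))
    (U : Finset (Fin n)) : Prop :=
  (G.induce (U : Set (Fin n))).Connected ∧ P.Mem (G.induce (U : Set (Fin n)))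

/-- The solutions on input `G`: the inclusion-maximal connected `P` sets of `G`. -/
def maxConnectedPSets (P : GraphClass) {n : ℕ} (G : SimpleGraph (Fin n)) :
    Set (Finset (Fin n)) :=
  {U | Maximal (IsConnectedPSet P G) U}

/-! ### Machine model: WHILE programs over binary trees, with unit-cost steps

This is the classical WHILE language on tree-structured data (nil, cons, head, tail, test for
nil), which is polynomial-time equivalent to multitape Turing machines; an output instruction
is added so that a program can enumerate. -/

/-- The data of the programs: binary trees. -/
inductive BTree : Type
  | nil : BTree
  | cons : BTree → BTree → BTree

namespace BTree

/-- Left subtree (`nil` for `nil`). -/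
def hd : BTree → BTree
  | nil => nil
  | cons a _ => a

/-- Right subtree (`nil` for `nil`). -/
def tl : BTree → BTree
  | nil => nil
  | cons _ b => b

/-- A list of trees as a tree. -/
def ofList : List BTree → BTree
  | [] => nil
  | a :: l => cons a (ofList l)

open Classical in
/-- A truth value as a tree. -/
noncomputable def bit (p : Prop) : BTree := if p then cons nil nil else nil

end BTree

/-- Programs. Variables are numbered by `ℕ`; a program mentions only finitely many. -/
inductive Prog : Type
  /-- `x := nil` -/
  | setNil (x : ℕ) : Prog
  /-- `x := y` -/
  | copy (x y : ℕ) : Prog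
  /-- `x := cons y z` -/
  | cons (x y z : ℕ) : Prog
  /-- `x := hd y` -/
  | hd (x y : ℕ) : Prog
  /-- `x := tl y` -/
  | tl (x y : ℕ) : Prog
  /-- output the value of `x` -/
  | emit (x : ℕ) : Prog
  /-- `c; d` -/
  | seq (c d : Prog) : Prog
  /-- `if x ≠ nil then c else d` -/
  | ite (x : ℕ) (c d : Prog) : Prog
  /-- `while x ≠ nil do c` -/
  | while (x : ℕ) (c : Prog) : Prog

/-- A store assigns a tree to every variable. -/
abbrev Store : Type := ℕ → BTree

/-- The record of a computation, in chronological order, with exactly one entry per step: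
`none` for a step without output and `some v` for a step that outputs `v`. Its length is the
number of steps of the computation. -/
abbrev Trace : Type := List (Option BTree)

/-- `Exec c σ t τ`: program `c`, started in store `σ`, halts in store `τ`, and its computation
has trace `t`. Every assignment, every output, and every evaluation of a test of an `if` or a
`while` is one step. -/
inductive Exec : Prog → Store → Trace → Store → Prop
  | setNil (x : ℕ) (σ : Store) :
      Exec (.setNil x) σ [none] (Function.update σ x .nil)
  | copy (x y : ℕ) (σ : Store) :
      Exec (.copy x y) σ [none] (Function.update σ x (σ y))
  | cons (x y z : ℕ) (σ : Store) :
      Exec (.cons x y z) σ [none] (Function.update σ x (.cons (σ y) (σ z)))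
  | hd (x y : ℕ) (σ : Store) :
      Exec (.hd x y) σ [none] (Function.update σ x (σ y).hd)
  | tl (x y : ℕ) (σ : Store) :
      Exec (.tl x y) σ [none] (Function.update σ x (σ y).tl)
  | emit (x : ℕ) (σ : Store) :
      Exec (.emit x) σ [some (σ x)] σ
  | seq {c d : Prog} {σ₁ σ₂ σ₃ : Store} {t u : Trace} :
      Exec c σ₁ t σ₂ → Exec d σ₂ u σ₃ → Exec (.seq c d) σ₁ (t ++ u) σ₃
  | iteTrue {x : ℕ} {c d : Prog} {σ₁ σ₂ : Store} {t : Trace} :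
      σ₁ x ≠ .nil → Exec c σ₁ t σ₂ → Exec (.ite x c d) σ₁ (none :: t) σ₂
  | iteFalse {x : ℕ} {c d : Prog} {σ₁ σ₂ : Store} {t : Trace} :
      σ₁ x = .nil → Exec d σ₁ t σ₂ → Exec (.ite x c d) σ₁ (none :: t) σ₂
  | whileTrue {x : ℕ} {c : Prog} {σ₁ σ₂ σ₃ : Store} {t u : Trace} :
      σ₁ x ≠ .nil → Exec c σ₁ t σ₂ → Exec (.while x c) σ₂ u σ₃ →
      Exec (.while x c) σ₁ (none :: (t ++ u)) σ₃
  | whileFalse {x : ℕ} {c : Prog} {σ : Store} :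
      σ x = .nil → Exec (.while x c) σ [none] σ

/-- The language is deterministic: a program has at most one computation from a given store. -/
theorem Exec.unique {c : Prog} {σ τ τ' : Store} {t t' : Trace}
    (h : Exec c σ t τ) (h' : Exec c σ t' τ') : t = t' ∧ τ = τ' := by
  induction h generalizing t' τ' with
  | setNil x σ => cases h'; exact ⟨rfl, rfl⟩
  | copy x y σ => cases h'; exact ⟨rfl, rfl⟩
  | cons x y z σ => cases h'; exact ⟨rfl, rfl⟩
  | hd x y σ => cases h'; exact ⟨rfl, rfl⟩
  | tl x y σ => cases h'; exact ⟨rfl, rfl⟩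
  | emit x σ => cases h'; exact ⟨rfl, rfl⟩
  | seq _ _ ih₁ ih₂ =>
    cases h' with
    | seq a b =>
      obtain ⟨rfl, rfl⟩ := ih₁ a
      obtain ⟨rfl, rfl⟩ := ih₂ b
      exact ⟨rfl, rfl⟩
  | iteTrue hx _ ih =>
    cases h' with
    | iteTrue _ a => obtain ⟨rfl, rfl⟩ := ih a; exact ⟨rfl, rfl⟩
    | iteFalse hx' _ => exact absurd hx' hx
  | iteFalse hx _ ih =>
    cases h' with
    | iteTrue hx' _ => exact absurd hx hx'
    | iteFalse _ a => obtain ⟨rfl, rfl⟩ := ih a; exact ⟨rfl, rfl⟩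
  | whileTrue hx _ _ ih₁ ih₂ =>
    cases h' with
    | whileTrue _ a b =>
      obtain ⟨rfl, rfl⟩ := ih₁ a
      obtain ⟨rfl, rfl⟩ := ih₂ b
      exact ⟨rfl, rfl⟩
    | whileFalse hx' => exact absurd hx' hx
  | whileFalse hx =>
    cases h' with
    | whileTrue hx' _ _ => exact absurd hx hx'
    | whileFalse _ => exact ⟨rfl, rfl⟩

/-! ### Enumeration problems and their complexity -/

/-- The input graph as a tree: its adjacency matrix, a list of `n` rows of `n` bits. -/
noncomputable def encodeGraph {n : ℕ} (G : SimpleGraph (Fin n)) : BTree :=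
  BTree.ofList (List.ofFn fun i : Fin n =>
    BTree.ofList (List.ofFn fun j : Fin n => BTree.bit (G.Adj i j)))

/-- A vertex set as a tree: its characteristic vector, a list of `n` bits. -/
noncomputable def encodeVertexSet {n : ℕ} (U : Finset (Fin n)) : BTree :=
  BTree.ofList (List.ofFn fun i : Fin n => BTree.bit (i ∈ U))

/-- The initial store: variable `0` holds the input, all others hold `nil`. -/
def initStore (v : BTree) : Store := fun x => if x = 0 then v else .nil

/-- The values output during a computation, in the order in which they are output. -/
def Trace.outputs (t : Trace) : List BTree := t.reduceOption

/-- `c`, run on the graph `G`, halts with trace `t`, having output every maximal connected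
`P` set of `G` exactly once and nothing else. -/
def EnumeratesOn (P : GraphClass) (c : Prog) {n : ℕ} (G : SimpleGraph (Fin n))
    (t : Trace) : Prop :=
  (∃ τ : Store, Exec c (initStore (encodeGraph G)) t τ) ∧
  t.outputs.Nodup ∧
  ∀ v : BTree, v ∈ t.outputs ↔ ∃ U ∈ maxConnectedPSets P G, encodeVertexSet U = v

/-- The maximal connected induced `P` subgraphs problem can be solved in polynomial total time:
on every graph with `n` vertices and `N` solutions, some fixed program enumerates the solutions
and halts after at most `p(n, N)` steps, for some fixed polynomial `p`. -/
def SolvableInPolyTotalTime (P : GraphClass) : Prop :=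
  ∃ (c : Prog) (p : MvPolynomial (Fin 2) ℕ),
    ∀ (n : ℕ) (G : SimpleGraph (Fin n)), ∃ t : Trace, EnumeratesOn P c G t ∧
      t.length ≤ MvPolynomial.eval ![n, (maxConnectedPSets P G).ncard] p

/-- The maximal connected induced `P` subgraphs problem can be solved in incremental polynomial
time: on every graph with `n` vertices and `N` solutions, some fixed program enumerates the
solutions, and for `1 ≤ s ≤ N` its first `p(n, s)` steps include the output of the `s`-th
solution, for some fixed polynomial `p`. -/
def SolvableInIncrementalPolyTime (P : GraphClass) : Prop :=
  ∃ (c : Prog) (p : MvPolynomial (Fin 2) ℕ),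
    ∀ (n : ℕ) (G : SimpleGraph (Fin n)), ∃ t : Trace, EnumeratesOn P c G t ∧
      ∀ s : ℕ, 1 ≤ s → s ≤ (maxConnectedPSets P G).ncard →
        s ≤ (Trace.outputs (t.take (MvPolynomial.eval ![n, s] p))).length

/-!
An algorithm running in incremental polynomial time, with bound `p (n, s)`, may run on for a long
time after its last output. It becomes an algorithm running in polynomial total time when it is
restarted with the clocks `p (n, s + 1)`, `s = 0, 1, …`, until at most `s` solutions have been
output by the time the clock runs out: these are then all solutions.

Conversely, it is enough to find, from a list `L` of solutions, a further one or to recognise that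
there is none. `L` is incomplete iff for some `U ∈ L ∪ {∅}` and some vertex `v` the set `U ∪ {v}`
contains a connected `P`-set that is *uncovered*, i.e. contained in no member of `L`. Suppose that
all connected `P`-sets inside `K ⊆ U ∪ {v}` are covered, and isolate the vertices outside `K`. The
resulting graph has at most `|L| + n` solutions: those that contain `v` and lie inside `K` are at
most `|L|` in number, since two of them in the same member of `L` have a connected union, which is
a `P`-set by heredity; the remaining ones are singletons or lie inside `U`, hence are pairwise
disjoint. So a run of the total-time algorithm on this graph, with a clock for that many solutions,
decides whether `K` contains an uncovered connected `P`-set: if the clock runs out, then it does.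
Discarding vertices one by one from such a `K` leaves an uncovered connected `P`-set. Adding
vertices one by one then gives a solution outside `L`, where clocked runs with `L = {K}` and
`U = K` decide whether `K` is a connected `P`-set.
-/

/-! ### Polynomially bounded functions -/

/-- `f` is polynomially bounded in `m`. The base is `m a + 2` so that sums and constants are
absorbed by a larger exponent even where `m a ≤ 1`. -/
def PolyBdd {α : Type*} (m f : α → ℕ) : Prop := ∃ d : ℕ, ∀ a, f a ≤ (m a + 2) ^ d

namespace PolyBdd

variable {α β : Type*} {m m' f g : α → ℕ}

theorem mono (hf : PolyBdd m f) (h : ∀ a, g a ≤ f a) : PolyBdd m g :=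
  hf.imp fun _ hd a => (h a).trans (hd a)

theorem base_pow (m : α → ℕ) (d : ℕ) : PolyBdd m fun a => (m a + 2) ^ d := ⟨d, fun _ => le_rfl⟩

theorem self (m : α → ℕ) : PolyBdd m m := (base_pow m 1).mono fun a => by simp

theorem const (m : α → ℕ) (k : ℕ) : PolyBdd m fun _ => k :=
  (base_pow m k).mono fun _ => Nat.lt_two_pow_self.le.trans (Nat.pow_le_pow_left (by lia) k)

theorem mul (hf : PolyBdd m f) (hg : PolyBdd m g) : PolyBdd m fun a => f a * g a := by
  obtain ⟨d, hd⟩ := hf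
  obtain ⟨e, he⟩ := hg
  exact ⟨d + e, fun a => by rw [pow_add]; exact Nat.mul_le_mul (hd a) (he a)⟩

theorem add (hf : PolyBdd m f) (hg : PolyBdd m g) : PolyBdd m fun a => f a + g a := by
  obtain ⟨d, hd⟩ := hf
  obtain ⟨e, he⟩ := hg
  refine ((const m 2).mul (base_pow m (max d e))).mono fun a => ?_
  rw [two_mul]
  exact add_le_add ((hd a).trans (Nat.pow_le_pow_right (by lia) (le_max_left d e)))
    ((he a).trans (Nat.pow_le_pow_right (by lia) (le_max_right d e)))

theorem pow (hf : PolyBdd m f) (k : ℕ) : PolyBdd m fun a => f a ^ k := by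
  obtain ⟨d, hd⟩ := hf
  exact ⟨d * k, fun a => by rw [pow_mul]; exact Nat.pow_le_pow_left (hd a) k⟩

theorem trans (hf : PolyBdd m f) (hm : PolyBdd m' m) : PolyBdd m' f := by
  obtain ⟨d, hd⟩ := hf
  exact ((hm.add (const m' 2)).pow d).mono hd

theorem reindex (φ : β → α) (hf : PolyBdd m f) : PolyBdd (fun b => m (φ b)) fun b => f (φ b) :=
  hf.imp fun _ hd b => hd (φ b)

end PolyBdd

theorem polyBdd_eval {ι : Type*} [Fintype ι] (p : MvPolynomial ι ℕ) :
    PolyBdd (fun x : ι → ℕ => ∑ i, x i) fun x => MvPolynomial.eval x p := by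
  induction p using MvPolynomial.induction_on with
  | C k => simpa using PolyBdd.const _ k
  | add p q hp hq => simpa using hp.add hq
  | mul_X p i hp =>
    have hi : PolyBdd (fun x : ι → ℕ => ∑ i, x i) fun x => x i :=
      (PolyBdd.self _).mono fun x => Finset.single_le_sum (fun _ _ => Nat.zero_le _)
        (Finset.mem_univ i)
    simpa using hp.mul hi

/-! ### Trees and traces -/

namespace BTree

@[simp] theorem tl_nil : tl nil = nil := rfl
@[simp] theorem hd_cons (a b : BTree) : hd (cons a b) = a := rfl
@[simp] theorem tl_cons (a b : BTree) : tl (cons a b) = b := rfl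
@[simp] theorem ofList_nil : ofList [] = nil := rfl
@[simp] theorem ofList_cons (a : BTree) (l : List BTree) :
    ofList (a :: l) = cons a (ofList l) := rfl

@[simp] theorem bit_true : bit True = cons nil nil := by simp [bit]
@[simp] theorem bit_false : bit False = nil := by simp [bit]

@[simp] theorem bit_eq_nil {p : Prop} : bit p = nil ↔ ¬ p := by
  by_cases h : p <;> simp [bit, h]

theorem bit_inj {p q : Prop} : bit p = bit q ↔ (p ↔ q) := by
  by_cases h : p <;> by_cases h' : q <;> simp [h, h']

@[simp] theorem ofList_eq_nil {l : List BTree} : ofList l = nil ↔ l = [] := by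
  cases l <;> simp

theorem ofList_injective : Function.Injective ofList := by
  intro l
  induction l with
  | nil => exact fun l' h => (ofList_eq_nil.1 h.symm).symm
  | cons a l ih =>
    rintro (_ | ⟨b, l'⟩) h
    · simp at h
    · simp only [ofList_cons, cons.injEq] at h
      rw [h.1, ih h.2]

/-- The number `k` in unary. -/
def unary (k : ℕ) : BTree := ofList (List.replicate k nil)

@[simp] theorem unary_eq_nil {k : ℕ} : unary k = nil ↔ k = 0 := by simp [unary]
@[simp] theorem tl_unary (k : ℕ) : (unary k).tl = unary (k - 1) := by cases k <;> rfl

end BTree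

namespace Trace

@[simp] theorem outputs_nil : Trace.outputs [] = [] := rfl
@[simp] theorem outputs_cons_none (t : Trace) : Trace.outputs (none :: t) = Trace.outputs t := by
  simp [Trace.outputs]
@[simp] theorem outputs_cons_some (v : BTree) (t : Trace) :
    Trace.outputs (some v :: t) = v :: Trace.outputs t := by
  simp [Trace.outputs]
@[simp] theorem outputs_append (t u : Trace) :
    Trace.outputs (t ++ u) = Trace.outputs t ++ Trace.outputs u := by
  simp [Trace.outputs, List.reduceOption_append]

theorem outputs_take_prefix_outputs (t : Trace) (k : ℕ) : Trace.outputs (t.take k) <+: t.outputs :=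
  ⟨_, by rw [← outputs_append, List.take_append_drop]⟩

theorem length_outputs_take_mono (t : Trace) {k l : ℕ} (h : k ≤ l) :
    (Trace.outputs (t.take k)).length ≤ (Trace.outputs (t.take l)).length := by
  simpa [List.take_take, h] using (outputs_take_prefix_outputs (t.take l) k).length_le

end Trace

/-! ### Frame property -/

/-- A number exceeding all variables of the program; variables from there on are free to be used
as scratch space around it. -/
def Prog.bound : Prog → ℕ
  | .setNil x => x + 1
  | .copy x y => x + y + 1
  | .cons x y z => x + y + z + 1
  | .hd x y => x + y + 1
  | .tl x y => x + y + 1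
  | .emit x => x + 1
  | .seq c d => max c.bound d.bound
  | .ite x c d => max (x + 1) (max c.bound d.bound)
  | .while x c => max (x + 1) c.bound

theorem Exec.frame {c : Prog} {σ τ : Store} {t : Trace} (h : Exec c σ t τ) {x : ℕ}
    (hx : c.bound ≤ x) : τ x = σ x := by
  induction h with
  | emit => rfl
  | seq _ _ ih₁ ih₂ =>
    simp only [Prog.bound, max_le_iff] at hx
    rw [ih₂ hx.2, ih₁ hx.1]
  | iteTrue _ _ ih => simp only [Prog.bound, max_le_iff] at hx; exact ih hx.2.1
  | iteFalse _ _ ih => simp only [Prog.bound, max_le_iff] at hx; exact ih hx.2.2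
  | whileTrue _ _ _ ih₁ ih₂ =>
    rw [ih₂ hx]
    simp only [Prog.bound, max_le_iff] at hx
    exact ih₁ hx.2
  | whileFalse => rfl
  | _ => simp only [Prog.bound] at hx; exact Function.update_of_ne (by lia) _ _

/-! ### Silent computations -/

/-- Program `c`, started in store `σ`, halts in store `τ` after at most `k` steps, without
output. -/
def SilentExec (c : Prog) (σ : Store) (k : ℕ) (τ : Store) : Prop :=
  ∃ t : Trace, Exec c σ t τ ∧ t.outputs = [] ∧ t.length ≤ k

namespace SilentExec

variable {c d : Prog} {σ σ₁ σ₂ σ₃ τ : Store} {k l x : ℕ}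

theorem of_exec (h : Exec c σ [none] τ) : SilentExec c σ 1 τ := ⟨_, h, by simp, by simp⟩

theorem mono (h : SilentExec c σ k τ) (hkl : k ≤ l) : SilentExec c σ l τ :=
  let ⟨t, e, ho, hl⟩ := h
  ⟨t, e, ho, hl.trans hkl⟩

theorem seq (h₁ : SilentExec c σ₁ k σ₂) (h₂ : SilentExec d σ₂ l σ₃) :
    SilentExec (.seq c d) σ₁ (k + l) σ₃ := by
  obtain ⟨t, e₁, o₁, l₁⟩ := h₁
  obtain ⟨u, e₂, o₂, l₂⟩ := h₂
  exact ⟨_, e₁.seq e₂, by simp [o₁, o₂], by simpa using add_le_add l₁ l₂⟩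

theorem exists_of_seq (h : SilentExec (.seq c d) σ k τ) :
    ∃ ρ k₁ k₂, k₁ + k₂ ≤ k ∧ SilentExec c σ k₁ ρ ∧ SilentExec d ρ k₂ τ := by
  obtain ⟨_, e, ho, hk⟩ := h
  cases e with
  | @seq _ _ _ ρ _ t u e₁ e₂ =>
    rw [Trace.outputs_append, List.append_eq_nil_iff] at ho
    exact ⟨ρ, t.length, u.length, by simpa using hk, ⟨t, e₁, ho.1, le_rfl⟩, ⟨u, e₂, ho.2, le_rfl⟩⟩

theorem iteTrue (hx : σ x ≠ .nil) (h : SilentExec c σ k τ) :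
    SilentExec (.ite x c d) σ (k + 1) τ := by
  obtain ⟨t, e, o, l⟩ := h
  exact ⟨_, e.iteTrue hx, by simpa using o, by simpa using l⟩

theorem iteFalse (hx : σ x = .nil) (h : SilentExec d σ k τ) :
    SilentExec (.ite x c d) σ (k + 1) τ := by
  obtain ⟨t, e, o, l⟩ := h
  exact ⟨_, e.iteFalse hx, by simpa using o, by simpa using l⟩

theorem whileTrue (hx : σ₁ x ≠ .nil) (h₁ : SilentExec c σ₁ k σ₂)
    (h₂ : SilentExec (.while x c) σ₂ l σ₃) : SilentExec (.while x c) σ₁ (k + l + 1) σ₃ := by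
  obtain ⟨t, e₁, o₁, l₁⟩ := h₁
  obtain ⟨u, e₂, o₂, l₂⟩ := h₂
  exact ⟨_, e₁.whileTrue hx e₂, by simp [o₁, o₂], by simpa using add_le_add l₁ l₂⟩

theorem whileFalse (hx : σ x = .nil) : SilentExec (.while x c) σ 1 σ := .of_exec (.whileFalse hx)

theorem frame (h : SilentExec c σ k τ) (hx : c.bound ≤ x) : τ x = σ x :=
  let ⟨_, e, _⟩ := h
  e.frame hx

end SilentExec

/-! ### Polynomial-time transformations of trees -/

/-- Some program turns, for every index `a`, the tree `i a` in variable `0` into the tree `o a`,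
without output and in time polynomial in `m a`. -/
def PolyTime {α : Type*} (m : α → ℕ) (i o : α → BTree) : Prop :=
  ∃ (c : Prog) (T : α → ℕ), PolyBdd m T ∧ ∀ a σ, σ 0 = i a →
    ∃ τ, SilentExec c σ (T a) τ ∧ τ 0 = o a

namespace PolyTime

variable {α β : Type*} {m m' : α → ℕ} {i f g o : α → BTree} {p q : α → Prop}

theorem congr (h : PolyTime m i o) (ho : ∀ a, o a = f a) : PolyTime m i f := by
  rwa [← funext ho]

theorem congr_left (h : PolyTime m i o) (hi : ∀ a, i a = f a) : PolyTime m f o := by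
  rwa [← funext hi]

theorem reindex (φ : β → α) (h : PolyTime m i o) :
    PolyTime (fun b => m (φ b)) (fun b => i (φ b)) (fun b => o (φ b)) :=
  let ⟨c, _, hT, hc⟩ := h
  ⟨c, _, hT.reindex φ, fun b => hc (φ b)⟩

theorem measure (h : PolyTime m i o) (hm : PolyBdd m' m) : PolyTime m' i o :=
  let ⟨c, _, hT, hc⟩ := h
  ⟨c, _, hT.trans hm, hc⟩

theorem of_exec (c : Prog) (h : ∀ a σ, σ 0 = i a → ∃ τ, Exec c σ [none] τ ∧ τ 0 = o a) :
    PolyTime m i o :=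
  ⟨c, fun _ => 1, .const m 1, fun a σ hσ => (h a σ hσ).imp fun _ hτ => ⟨.of_exec hτ.1, hτ.2⟩⟩

theorem comp (h₁ : PolyTime m i f) (h₂ : PolyTime m f o) : PolyTime m i o := by
  obtain ⟨c, T, hT, hc⟩ := h₁
  obtain ⟨d, S, hS, hd⟩ := h₂
  refine ⟨.seq c d, _, hT.add hS, fun a σ h => ?_⟩
  obtain ⟨τ, e₁, r₁⟩ := hc a σ h
  obtain ⟨ρ, e₂, r₂⟩ := hd a τ r₁
  exact ⟨ρ, e₁.seq e₂, r₂⟩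

theorem id (m : α → ℕ) (i : α → BTree) : PolyTime m i i :=
  of_exec (.copy 0 0) fun _ σ h => ⟨_, .copy 0 0 σ, by simpa using h⟩

theorem nil : PolyTime m i fun _ => .nil :=
  of_exec (.setNil 0) fun _ σ _ => ⟨_, .setNil 0 σ, by simp⟩

theorem hd (h : PolyTime m i f) : PolyTime m i fun a => (f a).hd :=
  h.comp <| of_exec (.hd 0 0) fun _ σ h => ⟨_, .hd 0 0 σ, by simp [h]⟩

theorem tl (h : PolyTime m i f) : PolyTime m i fun a => (f a).tl :=
  h.comp <| of_exec (.tl 0 0) fun _ σ h => ⟨_, .tl 0 0 σ, by simp [h]⟩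

theorem fst (h : PolyTime m i fun a => .cons (f a) (g a)) : PolyTime m i f := h.hd

theorem snd (h : PolyTime m i fun a => .cons (f a) (g a)) : PolyTime m i g := h.tl

theorem cons (hf : PolyTime m i f) (hg : PolyTime m i g) :
    PolyTime m i fun a => .cons (f a) (g a) := by
  obtain ⟨c, T, hT, hc⟩ := hf
  obtain ⟨d, S, hS, hd⟩ := hg
  obtain ⟨x, hx₀, hx₁, hx₂⟩ : ∃ x, 0 < x ∧ c.bound ≤ x ∧ d.bound ≤ x :=
    ⟨c.bound + d.bound + 1, by lia, by lia, by lia⟩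
  refine ⟨.seq (.copy x 0) (.seq c (.seq (.copy (x + 1) 0) (.seq (.copy 0 x)
    (.seq d (.cons 0 (x + 1) 0))))), fun a => T a + S a + 4, (hT.add hS).add (.const m 4),
    fun a σ h => ?_⟩
  obtain ⟨τ, e₁, r₁⟩ := hc a (Function.update σ x (σ 0))
    (by rw [Function.update_of_ne (by lia), h])
  have input_saved : τ x = i a := by rw [e₁.frame hx₁]; simp [h]
  obtain ⟨ρ, e₂, r₂⟩ := hd a
    (Function.update (Function.update τ (x + 1) (τ 0)) 0 (Function.update τ (x + 1) (τ 0) x))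
    (by simp [input_saved])
  have head_saved : ρ (x + 1) = f a := by rw [e₂.frame (by lia)]; simp [r₁]
  exact ⟨_, ((SilentExec.of_exec (.copy x 0 σ)).seq <| e₁.seq <|
    (SilentExec.of_exec (.copy (x + 1) 0 τ)).seq <| (SilentExec.of_exec (.copy 0 x _)).seq <|
    e₂.seq <| .of_exec (.cons 0 (x + 1) 0 ρ)).mono (by lia), by simp [head_saved, r₂]⟩

theorem cases {x : α → BTree} (hx : PolyTime m i x)
    (hf : PolyTime (fun a : {a // x a ≠ .nil} => m a) (fun a => i a) (fun a => f a))
    (hg : PolyTime (fun a : {a // x a = .nil} => m a) (fun a => i a) (fun a => f a)) :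
    PolyTime m i f := by
  obtain ⟨c, T, hT, hc⟩ := hx.cons (PolyTime.id m i)
  obtain ⟨d, S, ⟨s, hS⟩, hd⟩ := hf
  obtain ⟨e, R, ⟨r, hR⟩, he⟩ := hg
  refine ⟨.seq c (.seq (.hd 1 0) (.seq (.tl 0 0) (.ite 1 d e))), _,
    (hT.add ((PolyBdd.base_pow m s).add (.base_pow m r))).add (.const m 3), fun a σ h => ?_⟩
  obtain ⟨τ, e₁, r₁⟩ := hc a σ h
  let τ' := Function.update (Function.update τ 1 (τ 0).hd) 0 (Function.update τ 1 (τ 0).hd 0).tl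
  suffices ∃ ρ, SilentExec (.ite 1 d e) τ' ((m a + 2) ^ s + (m a + 2) ^ r + 1) ρ ∧ ρ 0 = f a by
    obtain ⟨ρ, e₂, r₂⟩ := this
    exact ⟨ρ, (e₁.seq <| (SilentExec.of_exec (.hd 1 0 τ)).seq <|
      (SilentExec.of_exec (.tl 0 0 _)).seq e₂).mono (by lia), r₂⟩
  by_cases hxa : x a = .nil
  · obtain ⟨ρ, e₂, r₂⟩ := he ⟨a, hxa⟩ τ' (by simp [τ', r₁])
    have := hR ⟨a, hxa⟩
    exact ⟨ρ, (SilentExec.iteFalse (by simp [τ', r₁, hxa]) e₂).mono (by lia), r₂⟩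
  · obtain ⟨ρ, e₂, r₂⟩ := hd ⟨a, hxa⟩ τ' (by simp [τ', r₁])
    have := hS ⟨a, hxa⟩
    exact ⟨ρ, (SilentExec.iteTrue (by simp [τ', r₁, hxa]) e₂).mono (by lia), r₂⟩

theorem ite [DecidablePred p] (hp : PolyTime m i fun a => .bit (p a))
    (hf : PolyTime m i f) (hg : PolyTime m i g) :
    PolyTime m i fun a => if p a then f a else g a :=
  hp.cases ((hf.reindex Subtype.val).congr fun a => by grind [BTree.bit_eq_nil])
    ((hg.reindex Subtype.val).congr fun a => by grind [BTree.bit_eq_nil])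

theorem bit_ne_nil (hf : PolyTime m i f) : PolyTime m i fun a => .bit (f a ≠ .nil) :=
  hf.cases ((nil.cons nil).congr fun a => by simp [a.2]) (nil.congr fun a => by simp [a.2])

theorem bit_not (hp : PolyTime m i fun a => .bit (p a)) :
    PolyTime m i fun a => .bit (¬ p a) := by
  classical
  refine (hp.ite nil (nil.cons nil)).congr fun a => ?_
  by_cases h : p a <;> simp [h]

theorem bit_and (hp : PolyTime m i fun a => .bit (p a)) (hq : PolyTime m i fun a => .bit (q a)) :
    PolyTime m i fun a => .bit (p a ∧ q a) := by
  classical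
  refine (hp.ite hq nil).congr fun a => ?_
  by_cases h : p a <;> simp [h]

theorem bit_or (hp : PolyTime m i fun a => .bit (p a)) (hq : PolyTime m i fun a => .bit (q a)) :
    PolyTime m i fun a => .bit (p a ∨ q a) := by
  classical
  refine (hp.ite (nil.cons nil) hq).congr fun a => ?_
  by_cases h : p a <;> simp [h]

theorem loop {N : α → ℕ} (st : α → ℕ → BTree) (hN : PolyBdd m N)
    (hd_ne_nil : ∀ a j, j < N a → (st a j).hd ≠ .nil) (hd_eq_nil : ∀ a, (st a (N a)).hd = .nil)
    (h : PolyTime (fun p : Σ a, Fin (N a) => m p.1)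
      (fun p => st p.1 p.2) (fun p => st p.1 (p.2 + 1))) :
    PolyTime m (fun a => st a 0) (fun a => st a (N a)) := by
  obtain ⟨c, T, ⟨d, hT⟩, hc⟩ := h
  have run_from : ∀ a k j, k + j = N a → ∀ σ : Store, σ 0 = st a j → σ 1 = (st a j).hd →
      ∃ τ, SilentExec (.while 1 (.seq c (.hd 1 0))) σ (k * ((m a + 2) ^ d + 2) + 1) τ ∧
        τ 0 = st a (N a) := by
    intro a k
    induction k with
    | zero =>
      rintro j hj σ h₀ h₁
      obtain rfl : j = N a := by lia
      exact ⟨σ, (SilentExec.whileFalse (by rw [h₁, hd_eq_nil])).mono (by lia), h₀⟩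
    | succ k ih =>
      intro j hj σ h₀ h₁
      have hlt : j < N a := by lia
      obtain ⟨τ, e₁, r₁⟩ := hc ⟨a, j, hlt⟩ σ h₀
      obtain ⟨ρ, e₂, r₂⟩ := ih (j + 1) (by lia) (Function.update τ 1 (τ 0).hd)
        (by simpa using r₁) (by simp [r₁])
      have := hT ⟨a, j, hlt⟩
      exact ⟨ρ, (SilentExec.whileTrue (by rw [h₁]; exact hd_ne_nil a j hlt)
        (e₁.seq (.of_exec (.hd 1 0 τ))) e₂).mono (by rw [add_mul]; lia), r₂⟩
  refine ⟨.seq (.hd 1 0) (.while 1 (.seq c (.hd 1 0))), _, ((PolyBdd.const m 1).add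
    ((hN.mul ((PolyBdd.base_pow m d).add (.const m 2))).add (.const m 1))), fun a σ h => ?_⟩
  obtain ⟨ρ, e, r⟩ := run_from a (N a) 0 rfl (Function.update σ 1 (σ 0).hd)
    (by simpa using h) (by simp [h])
  exact ⟨ρ, (SilentExec.of_exec (.hd 1 0 σ)).seq e, r⟩

end PolyTime

/-! ### Running a program with a clock -/

namespace Prog

/-- `c`, as one step of a clocked program: skipped when the clock `b` has run out. -/
def guarded (b : ℕ) (c : Prog) : Prog := .ite b (.seq (.tl b b) c) (.copy b b)

/-- The test of a loop on `x` as a step of a clocked program: its result is stored in `b + 2`, and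
is `nil` when the clock `b` has run out. -/
def guardedTest (b x : ℕ) : Prog :=
  .ite b (.seq (.tl b b) (.copy (b + 2) x)) (.setNil (b + 2))

/-- The loop on `x` with body `c` in a clocked program. -/
def clockedWhile (b x : ℕ) (c : Prog) : Prog :=
  .seq (guardedTest b x) (.while (b + 2) (.seq c (guardedTest b x)))

/-- The program that runs like `c` for as many steps as the list in variable `b` has elements,
and collects the outputs in variable `b + 1`, the latest one first. -/
def clocked (b : ℕ) : Prog → Prog
  | .setNil x => guarded b (.setNil x)
  | .copy x y => guarded b (.copy x y)
  | .cons x y z => guarded b (.cons x y z)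
  | .hd x y => guarded b (.hd x y)
  | .tl x y => guarded b (.tl x y)
  | .emit x => guarded b (.cons (b + 1) x (b + 1))
  | .seq c d => .seq (clocked b c) (clocked b d)
  | .ite x c d => guarded b (.ite x (clocked b c) (clocked b d))
  | .while x c => clockedWhile b x (clocked b c)

/-- A factor by which the clocked program is slower than the program itself. -/
def overhead : Prog → ℕ
  | .seq c d => c.overhead + d.overhead
  | .ite _ c d => c.overhead + d.overhead + 3
  | .while _ c => c.overhead + 10
  | _ => 3

/-- Set the variables `1, …, k` to `nil`. -/
def clear : ℕ → Prog
  | 0 => .copy 0 0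
  | k + 1 => .seq (clear k) (.setNil (k + 1))

/-- Turn an input `(v, B)` into the input `v` and the clock `B` in variable `k + 1`, with the
variables `1, …, k` empty and no outputs in variable `k + 2`. -/
def startClock (k : ℕ) : Prog :=
  .seq (.tl (k + 1) 0) (.seq (.hd 0 0) (.seq (.setNil (k + 2)) (clear k)))

end Prog

/-- `σ'` is a store of a clocked program that simulates the store `σ` with `B` steps left, after
the outputs in `l`. Once the clock has run out, only the outputs matter. -/
structure ClockedStore (b : ℕ) (σ : Store) (B : ℕ) (l : List BTree) (σ' : Store) : Prop where
  agree : B ≠ 0 → ∀ x < b, σ' x = σ x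
  clock : σ' b = .unary B
  out : σ' (b + 1) = .ofList l

/-- `c'` simulates, with a slowdown by the factor `K`, the part that the clock permits of a
computation from `σ` to `τ` with trace `t`. -/
def ClockedSim (b K : ℕ) (c' : Prog) (σ : Store) (t : Trace) (τ : Store) : Prop :=
  ∀ σ' B l, ClockedStore b σ B l σ' →
    ∃ τ', SilentExec c' σ' (K * (min t.length B + 1)) τ' ∧
      ClockedStore b τ (B - t.length) ((Trace.outputs (t.take B)).reverse ++ l) τ'

namespace ClockedSim

variable {b K L B x : ℕ} {c' d' : Prog} {σ σ' σ₁ σ₂ σ₃ τ : Store} {t u : Trace} {v : Option BTree}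
  {l : List BTree}

theorem mono (h : ClockedSim b K c' σ t τ) (hKL : K ≤ L) : ClockedSim b L c' σ t τ :=
  fun σ' B l hσ => (h σ' B l hσ).imp fun _ h => ⟨h.1.mono (Nat.mul_le_mul_right _ hKL), h.2⟩

theorem seq (h₁ : ClockedSim b K c' σ₁ t σ₂) (h₂ : ClockedSim b L d' σ₂ u σ₃) :
    ClockedSim b (K + L) (.seq c' d') σ₁ (t ++ u) σ₃ := by
  intro σ' B l hσ
  obtain ⟨τ', e₁, hτ⟩ := h₁ σ' B l hσ
  obtain ⟨ρ', e₂, hρ⟩ := h₂ τ' _ _ hτ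
  refine ⟨ρ', (e₁.seq e₂).mono ?_, ?_⟩
  · rw [List.length_append, add_mul]
    gcongr <;> lia
  · simpa [List.take_append, Nat.sub_sub] using hρ

theorem guarded (hK : 3 ≤ K)
    (live : ∀ σ' B l, ClockedStore b σ B l σ' → (∀ x < b, σ' x = σ x) →
      ∃ k τ', k + 2 ≤ K * (min t.length B + 2) ∧ SilentExec c' σ' k τ' ∧
        ClockedStore b τ (B - t.length) ((Trace.outputs (v :: t.take B)).reverse ++ l) τ') :
    ClockedSim b K (c'.guarded b) σ (v :: t) τ := by
  intro σ' B l hσ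
  cases B with
  | zero =>
    exact ⟨σ', ((SilentExec.iteFalse hσ.clock (.of_exec (by
      simpa using Exec.copy b b σ'))).mono (by simp; lia)), by simp, by simp [hσ.clock],
      by simp [hσ.out]⟩
  | succ B =>
    have agree : ∀ x < b, Function.update σ' b (σ' b).tl x = σ x := fun x hx => by
      rw [Function.update_of_ne hx.ne, hσ.agree (by lia) x hx]
    obtain ⟨k, τ', hk, e, hτ⟩ := live (Function.update σ' b (σ' b).tl) B l
      ⟨fun _ => agree, by simp [hσ.clock], by simp [hσ.out]⟩ agree
    refine ⟨τ', (SilentExec.iteTrue (by simp [hσ.clock])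
      ((SilentExec.of_exec (.tl b b σ')).seq e)).mono ?_, by simpa using hτ⟩
    rw [List.length_cons, Nat.add_min_add_right]
    lia

theorem guarded_assign {w : BTree} (hx : x < b)
    (h : ∀ σ', (∀ y < b, σ' y = σ y) → Exec c' σ' [none] (Function.update σ' x w)) :
    ClockedSim b 3 (c'.guarded b) σ [none] (Function.update σ x w) :=
  guarded le_rfl fun σ' B l hσ agree => ⟨1, _, by lia, .of_exec (h σ' agree),
    fun _ y hy => by rcases eq_or_ne y x with rfl | hne <;> simp [*],
    by simp [hσ.clock, hx.ne'], by simp [hσ.out, (by lia : b + 1 ≠ x)]⟩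

theorem emit (hx : x < b) :
    ClockedSim b 3 (Prog.guarded b (.cons (b + 1) x (b + 1))) σ [some (σ x)] σ :=
  guarded le_rfl fun σ' B l hσ agree => ⟨1, _, by lia, .of_exec (.cons (b + 1) x (b + 1) σ'),
    fun _ y hy => by simp [agree y hy, (by lia : y ≠ b + 1)], by simp [hσ.clock],
    by simp [hσ.out, agree x hx]⟩

theorem iteTrue (hx : x < b) (hσx : σ x ≠ .nil) (h : ClockedSim b K c' σ t τ) :
    ClockedSim b (K + 3) (Prog.guarded b (.ite x c' d')) σ (none :: t) τ :=
  guarded (by lia) fun σ' B l hσ agree =>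
    let ⟨τ', e, hτ⟩ := h σ' B l hσ
    ⟨_, τ', by lia, e.iteTrue (by rwa [agree x hx]), by simpa using hτ⟩

theorem iteFalse (hx : x < b) (hσx : σ x = .nil) (h : ClockedSim b K d' σ t τ) :
    ClockedSim b (K + 3) (Prog.guarded b (.ite x c' d')) σ (none :: t) τ :=
  guarded (by lia) fun σ' B l hσ agree =>
    let ⟨τ', e, hτ⟩ := h σ' B l hσ
    ⟨_, τ', by lia, e.iteFalse (by rwa [agree x hx]), by simpa using hτ⟩

theorem clockedWhile (hK : 3 ≤ K) (hx : x < b)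
    (live : ∀ σ' B l, ClockedStore b σ B l σ' → σ' (b + 2) = σ x →
      ∃ k τ', k + 3 ≤ K * (min t.length B + 2) ∧
        SilentExec (.while (b + 2) (.seq c' (.guardedTest b x))) σ' k τ' ∧
        ClockedStore b τ (B - t.length) ((Trace.outputs (t.take B)).reverse ++ l) τ') :
    ClockedSim b K (.clockedWhile b x c') σ (none :: t) τ := by
  intro σ' B l hσ
  cases B with
  | zero =>
    exact ⟨_, (((SilentExec.of_exec (.setNil (b + 2) σ')).iteFalse hσ.clock).seq
      (.whileFalse (by simp))).mono (by simp; lia), by simp, by simp [hσ.clock], by simp [hσ.out]⟩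
  | succ B =>
    have agree := hσ.agree B.succ_ne_zero
    obtain ⟨k, τ', hk, e, hτ⟩ := live
      (Function.update (Function.update σ' b (σ' b).tl) (b + 2) (σ' x)) B l
      ⟨fun _ y hy => by simp [agree y hy, hy.ne, (by lia : y ≠ b + 2)], by simp [hσ.clock],
        by simp [hσ.out]⟩ (by simp [agree x hx])
    have test : SilentExec (.guardedTest b x) σ' 3 _ :=
      ((SilentExec.of_exec (.tl b b σ')).seq (.of_exec (.copy (b + 2) x _))).iteTrue
        (by simp [hσ.clock])
    refine ⟨τ', (test.seq (by simpa [hx.ne] using e)).mono ?_, by simpa using hτ⟩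
    rw [List.length_cons, Nat.add_min_add_right]
    lia

theorem whileFalse (hx : x < b) (hσx : σ x = .nil) :
    ClockedSim b (K + 10) (.clockedWhile b x c') σ [none] σ :=
  clockedWhile (by lia) hx fun σ' B l hσ test =>
    ⟨1, σ', by lia, .whileFalse (test.trans hσx), by simpa using hσ⟩

theorem whileTrue (hx : x < b) (hσx : σ₁ x ≠ .nil) (h₁ : ClockedSim b K c' σ₁ t σ₂)
    (h₂ : ClockedSim b (K + 10) (.clockedWhile b x c') σ₂ u σ₃) :
    ClockedSim b (K + 10) (.clockedWhile b x c') σ₁ (none :: (t ++ u)) σ₃ :=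
  clockedWhile (by lia) hx fun σ' B l hσ test => by
    obtain ⟨τ', e₁, hτ⟩ := h₁ σ' B l hσ
    obtain ⟨ρ', e₂, hρ⟩ := h₂ τ' _ _ hτ
    obtain ⟨ω', j, k, hjk, eTest, eLoop⟩ := e₂.exists_of_seq
    refine ⟨_, ρ', ?_, .whileTrue (by rwa [test]) (e₁.seq eTest) eLoop, ?_⟩
    · have : min (t ++ u).length B = min t.length B + min u.length (B - t.length) := by
        rw [List.length_append]; lia
      rw [this]
      linarith [Nat.zero_le (min t.length B)]
    · simpa [List.take_append, Nat.sub_sub] using hρ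

end ClockedSim

theorem Exec.clocked {b : ℕ} {c : Prog} {σ τ : Store} {t : Trace} (h : Exec c σ t τ)
    (hb : c.bound ≤ b) : ClockedSim b c.overhead (c.clocked b) σ t τ := by
  induction h with
  | setNil x σ =>
    simp only [Prog.bound] at hb
    exact .guarded_assign (by lia) fun σ' _ => .setNil x σ'
  | copy x y σ =>
    simp only [Prog.bound] at hb
    exact .guarded_assign (by lia) fun σ' h => h y (by lia) ▸ .copy x y σ'
  | cons x y z σ =>
    simp only [Prog.bound] at hb
    exact .guarded_assign (by lia) fun σ' h => h y (by lia) ▸ h z (by lia) ▸ .cons x y z σ'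
  | hd x y σ =>
    simp only [Prog.bound] at hb
    exact .guarded_assign (by lia) fun σ' h => h y (by lia) ▸ .hd x y σ'
  | tl x y σ =>
    simp only [Prog.bound] at hb
    exact .guarded_assign (by lia) fun σ' h => h y (by lia) ▸ .tl x y σ'
  | emit x σ => exact .emit hb
  | seq _ _ ih₁ ih₂ =>
    simp only [Prog.bound, max_le_iff] at hb
    exact (ih₁ hb.1).seq (ih₂ hb.2)
  | iteTrue hx _ ih =>
    simp only [Prog.bound, max_le_iff] at hb
    exact ((ih hb.2.1).iteTrue hb.1 hx).mono (by simp only [Prog.overhead]; lia)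
  | iteFalse hx _ ih =>
    simp only [Prog.bound, max_le_iff] at hb
    exact ((ih hb.2.2).iteFalse hb.1 hx).mono (by simp only [Prog.overhead]; lia)
  | whileTrue hx _ _ ih₁ ih₂ =>
    have := hb
    simp only [Prog.bound, max_le_iff] at this
    exact .whileTrue this.1 hx (ih₁ this.2) (ih₂ hb)
  | whileFalse hx =>
    simp only [Prog.bound, max_le_iff] at hb
    exact .whileFalse hb.1 hx

theorem SilentExec.clear (k : ℕ) (σ : Store) :
    ∃ τ, SilentExec (.clear k) σ (k + 1) τ ∧ ∀ x, τ x = if 0 < x ∧ x ≤ k then .nil else σ x := by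
  induction k with
  | zero => exact ⟨_, .of_exec (.copy 0 0 σ), fun x => by grind⟩
  | succ k ih =>
    obtain ⟨τ, e, hτ⟩ := ih
    exact ⟨_, e.seq (.of_exec (.setNil (k + 1) τ)), fun x => by grind⟩

theorem SilentExec.startClock {B : ℕ} {v : BTree} {σ : Store} (h : σ 0 = .cons v (.unary B))
    (k : ℕ) : ∃ τ, SilentExec (.startClock k) σ (k + 4) τ ∧
      ClockedStore (k + 1) (initStore v) B [] τ := by
  obtain ⟨τ, e, hτ⟩ := SilentExec.clear k (Function.update (Function.update
    (Function.update σ (k + 1) (σ 0).tl) 0 (Function.update σ (k + 1) (σ 0).tl 0).hd) (k + 2) .nil)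
  refine ⟨τ, ((SilentExec.of_exec (.tl (k + 1) 0 σ)).seq <|
    (SilentExec.of_exec (.hd 0 0 _)).seq <|
    (SilentExec.of_exec (.setNil (k + 2) _)).seq e).mono (by lia), fun _ x hx => ?_, ?_, ?_⟩
  · grind [initStore, BTree.hd_cons]
  · grind [BTree.tl_cons]
  · grind [BTree.ofList_nil]

theorem PolyTime.simulate {α : Type*} {m : α → ℕ} {i v : α → BTree} (c : Prog) {tr : α → Trace}
    (htr : ∀ a, ∃ τ, Exec c (initStore (v a)) (tr a) τ) {B : α → ℕ} (hB : PolyBdd m B)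
    (hv : PolyTime m i v) (hi : PolyTime m i fun a => .unary (B a)) :
    PolyTime m i fun a => .cons (.ofList (Trace.outputs ((tr a).take (B a))).reverse)
      (.unary (B a - (tr a).length)) := by
  refine (hv.cons hi).comp ⟨.seq (.startClock c.bound)
      (.seq (c.clocked (c.bound + 1)) (.cons 0 (c.bound + 2) (c.bound + 1))), _,
    (((PolyBdd.const m c.overhead).mul (hB.add (.const m 1))).add (.const m (c.bound + 5))),
    fun a σ h => ?_⟩
  obtain ⟨_, e⟩ := htr a
  obtain ⟨σ', start, hσ'⟩ := SilentExec.startClock h c.bound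
  obtain ⟨τ, run, hτ⟩ := e.clocked (Nat.le_succ _) σ' (B a) [] hσ'
  refine ⟨_, (start.seq (run.seq (.of_exec (.cons 0 _ _ τ)))).mono ?_, by
    simp [hτ.clock, hτ.out]⟩
  have : c.overhead * (min (tr a).length (B a) + 1) ≤ c.overhead * (B a + 1) := by gcongr; simp
  lia

/-! ### Polynomial-time operations on lists -/

/-- The values `o a b` are computable in polynomial time from the tree `e a b` that encodes an
additional argument `b`, in the context of the tree `i a`. -/
abbrev PolyTimeWith {α : Type*} {β : α → Type*} (m : α → ℕ) (i : α → BTree)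
    (e o : ∀ a, β a → BTree) : Prop :=
  PolyTime (fun p : Σ a, β a => m p.1) (fun p => .cons (e p.1 p.2) (i p.1)) fun p => o p.1 p.2

namespace PolyTimeWith

variable {α δ : Type*} {β : α → Type*} {m : α → ℕ} {i f g : α → BTree} {e o : ∀ a, β a → BTree}
  {i' : δ → BTree}

theorem arg : PolyTime m (fun a => .cons (f a) (g a)) f := (PolyTime.id _ _).fst

theorem context : PolyTime m (fun a => .cons (f a) (g a)) g := (PolyTime.id _ _).snd

theorem subst (φ : δ → Σ a, β a) (h : PolyTimeWith m i e o)
    (he : PolyTime (fun d => m (φ d).1) i' fun d => e (φ d).1 (φ d).2)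
    (hi : PolyTime (fun d => m (φ d).1) i' fun d => i (φ d).1) :
    PolyTime (fun d => m (φ d).1) i' fun d => o (φ d).1 (φ d).2 :=
  (he.cons hi).comp (h.reindex φ)

end PolyTimeWith

/-- An optional value as a tree. -/
def BTree.ofOption {δ : Type*} (e : δ → BTree) : Option δ → BTree
  | none => nil
  | some d => cons (e d) nil

@[simp] theorem BTree.ofOption_none {δ : Type*} (e : δ → BTree) : ofOption e none = nil := rfl
@[simp] theorem BTree.ofOption_some {δ : Type*} (e : δ → BTree) (d : δ) :
    ofOption e (some d) = cons (e d) nil := rfl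

namespace PolyTime

open PolyTimeWith

variable {α : Type*} {m : α → ℕ} {i f g : α → BTree} {β γ δ : α → Type*}

theorem foldIdx (L : α → List BTree) (acc : α → ℕ → BTree)
    (hn : PolyBdd m fun a => (L a).length) (hL : PolyTime m i fun a => .ofList (L a))
    (h₀ : PolyTime m i fun a => acc a 0)
    (h : PolyTimeWith m i (fun a (j : Fin (L a).length) => .cons (L a)[j] (acc a j))
      fun a j => acc a (j + 1)) :
    PolyTime m i fun a => acc a (L a).length := by
  let st (a : α) (j : ℕ) : BTree := .cons (.ofList ((L a).drop j)) (.cons (acc a j) (i a))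
  have start : PolyTime m i fun a => st a 0 := hL.cons (h₀.cons (.id m i))
  have step : PolyTime (fun p : Σ a, Fin (L a).length => m p.1) (fun p => st p.1 p.2)
      fun p => st p.1 (p.2 + 1) := by
    have split : PolyTime (fun p : Σ a, Fin (L a).length => m p.1) (fun p => st p.1 p.2)
        fun p => .cons (.cons (L p.1)[p.2] (.ofList ((L p.1).drop (p.2 + 1))))
          (.cons (acc p.1 p.2) (i p.1)) :=
      (PolyTime.id _ _).congr fun p => by
        simp only [st]
        rw [List.drop_eq_getElem_cons p.2.isLt, BTree.ofList_cons]
        rfl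
    exact split.fst.snd.cons
      ((((split.fst.fst.cons split.snd.fst).cons split.snd.snd).comp h).cons split.snd.snd)
  exact (start.comp (loop st hn (fun a j hj => by simpa [st] using hj) (fun a => by simp [st])
    step)).snd.fst

theorem foldl (l : ∀ a, List (β a)) (eb : ∀ a, β a → BTree) (eg : ∀ a, γ a → BTree)
    (F : ∀ a, γ a → β a → γ a) (g₀ : ∀ a, γ a)
    (hn : PolyBdd m fun a => (l a).length)
    (hl : PolyTime m i fun a => .ofList ((l a).map (eb a)))
    (h₀ : PolyTime m i fun a => eg a (g₀ a))
    (h : PolyTimeWith m i (fun a (p : γ a × β a) => .cons (eb a p.2) (eg a p.1))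
      fun a p => eg a (F a p.1 p.2)) :
    PolyTime m i fun a => eg a ((l a).foldl (F a) (g₀ a)) := by
  refine (foldIdx (fun a => (l a).map (eb a))
    (fun a j => eg a (((l a).take j).foldl (F a) (g₀ a))) (by simpa using hn) hl
    (by simpa using h₀) ?_).congr fun a => by simp
  let current (p : Σ a, Fin ((l a).map (eb a)).length) : Σ a, γ a × β a :=
    ⟨p.1, ((l p.1).take p.2).foldl (F p.1) (g₀ p.1), (l p.1)[p.2]'(by simpa using p.2.isLt)⟩
  refine (subst current h (arg.congr fun p => ?_) context).congr fun ⟨a, j⟩ => ?_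
  · simp [current]
  · have hj : (j : ℕ) < (l a).length := by simpa using j.isLt
    change _ = eg a (((l a).take (j + 1)).foldl (F a) (g₀ a))
    rw [List.take_succ_eq_append_getElem hj, List.foldl_append]
    rfl

theorem reverse (l : α → List BTree) (hn : PolyBdd m fun a => (l a).length)
    (hl : PolyTime m i fun a => .ofList (l a)) :
    PolyTime m i fun a => .ofList (l a).reverse :=
  (foldl (γ := fun _ => List BTree) l (fun _ b => b) (fun _ => .ofList)
    (fun _ acc b => b :: acc) (fun _ => []) hn (by simpa using hl) nil
    (arg.fst.cons arg.snd)).congr fun a => by simp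

open Classical in
theorem map_filter (l : ∀ a, List (β a)) (eb : ∀ a, β a → BTree) (q : ∀ a, β a → Prop)
    (r : ∀ a, β a → BTree) (hn : PolyBdd m fun a => (l a).length)
    (hl : PolyTime m i fun a => .ofList ((l a).map (eb a)))
    (hq : PolyTimeWith m i eb fun a b => .bit (q a b)) (hr : PolyTimeWith m i eb r) :
    PolyTime m i fun a => .ofList (((l a).filter fun b => q a b).map (r a)) := by
  let F (a : α) (acc : List BTree) (b : β a) := if q a b then r a b :: acc else acc
  have foldl_eq (a) (l' : List (β a)) (acc) :
      l'.foldl (F a) acc = ((l'.filter fun b => q a b).map (r a)).reverse ++ acc := by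
    induction l' generalizing acc with
    | nil => simp
    | cons b l' ih => by_cases hb : q a b <;> simp [F, ih, hb]
  have reversed : PolyTime m i fun a =>
      .ofList (((l a).filter fun b => q a b).map (r a)).reverse := by
    refine (foldl (γ := fun _ => List BTree) l eb (fun _ => .ofList) F (fun _ => []) hn hl nil
      ?_).congr fun a => by simp [foldl_eq]
    refine (ite (hq.subst (fun p : Σ a, _ × β a => ⟨p.1, p.2.2⟩) arg.fst context)
      ((hr.subst (fun p : Σ a, _ × β a => ⟨p.1, p.2.2⟩) arg.fst context).cons arg.snd)
      arg.snd).congr fun p => ?_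
    by_cases hb : q p.1 p.2.2 <;> simp [F, hb]
  exact (reversed.reverse _ (hn.mono fun a => by simpa using List.length_filter_le _ _)).congr
    fun a => by simp

theorem map (l : ∀ a, List (β a)) (eb : ∀ a, β a → BTree) (r : ∀ a, β a → BTree)
    (hn : PolyBdd m fun a => (l a).length)
    (hl : PolyTime m i fun a => .ofList ((l a).map (eb a))) (hr : PolyTimeWith m i eb r) :
    PolyTime m i fun a => .ofList ((l a).map (r a)) :=
  (map_filter l eb (fun _ _ => True) r hn hl ((nil.cons nil).congr fun p => by simp) hr).congr
    fun a => by simp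

theorem all (l : ∀ a, List (β a)) (eb : ∀ a, β a → BTree) (q : ∀ a, β a → Prop)
    (hn : PolyBdd m fun a => (l a).length)
    (hl : PolyTime m i fun a => .ofList ((l a).map (eb a)))
    (hq : PolyTimeWith m i eb fun a b => .bit (q a b)) :
    PolyTime m i fun a => .bit (∀ b ∈ l a, q a b) := by
  have foldl_iff (a) (l' : List (β a)) (p : Prop) :
      l'.foldl (fun p b => p ∧ q a b) p ↔ p ∧ ∀ b ∈ l', q a b := by
    induction l' generalizing p with
    | nil => simp
    | cons b l' ih => simp [ih, and_assoc]
  exact (foldl (γ := fun _ => Prop) l eb (fun _ => .bit) (fun a p b => p ∧ q a b)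
    (fun _ => True) hn hl ((nil.cons nil).congr fun _ => by simp)
    (arg.snd.bit_and (hq.subst (fun p : Σ a, _ × β a => ⟨p.1, p.2.2⟩) arg.fst context))).congr
    fun a => BTree.bit_inj.2 (by simp [foldl_iff])

theorem any (l : ∀ a, List (β a)) (eb : ∀ a, β a → BTree) (q : ∀ a, β a → Prop)
    (hn : PolyBdd m fun a => (l a).length)
    (hl : PolyTime m i fun a => .ofList ((l a).map (eb a)))
    (hq : PolyTimeWith m i eb fun a b => .bit (q a b)) :
    PolyTime m i fun a => .bit (∃ b ∈ l a, q a b) :=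
  (all l eb (fun a b => ¬ q a b) hn hl hq.bit_not).bit_not.congr fun a =>
    BTree.bit_inj.2 (by push Not; rfl)

theorem findSome (l : ∀ a, List (β a)) (eb : ∀ a, β a → BTree) (ed : ∀ a, δ a → BTree)
    (q : ∀ a, β a → Option (δ a)) (hn : PolyBdd m fun a => (l a).length)
    (hl : PolyTime m i fun a => .ofList ((l a).map (eb a)))
    (hq : PolyTimeWith m i eb fun a b => .ofOption (ed a) (q a b)) :
    PolyTime m i fun a => .ofOption (ed a) ((l a).findSome? (q a)) := by
  have foldl_eq (a) (l' : List (β a)) (acc : Option (δ a)) :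
      l'.foldl (fun acc b => acc.or (q a b)) acc = acc.or (l'.findSome? (q a)) := by
    induction l' generalizing acc with
    | nil => simp
    | cons b l' ih => cases acc <;> cases hb : q a b <;> simp [ih, hb]
  refine (foldl (γ := fun a => Option (δ a)) l eb (fun a => .ofOption (ed a))
    (fun a acc b => acc.or (q a b)) (fun _ => none) hn hl nil ?_).congr
    fun a => by simp [foldl_eq]
  refine cases arg.snd (arg.snd.congr ?_)
    ((hq.subst (fun p : {p : Σ a, Option (δ a) × β a // .ofOption (ed p.1) p.2.1 = BTree.nil} =>
      ⟨p.1.1, p.1.2.2⟩) arg.fst context).congr ?_)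
  · rintro ⟨⟨a, _ | _, b⟩, h⟩
    · simp at h
    · simp
  · rintro ⟨⟨a, _ | _, b⟩, h⟩
    · simp
    · simp at h

theorem zip (l : ∀ a, List (β a)) (e₁ e₂ : ∀ a, β a → BTree)
    (hn : PolyBdd m fun a => (l a).length)
    (h₁ : PolyTime m i fun a => .ofList ((l a).map (e₁ a)))
    (h₂ : PolyTime m i fun a => .ofList ((l a).map (e₂ a))) :
    PolyTime m i fun a => .ofList ((l a).map fun b => .cons (e₁ a b) (e₂ a b)) := by
  let pair (a : α) (b : β a) : BTree := .cons (e₁ a b) (e₂ a b)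
  have reversed : PolyTime m i fun a => .ofList ((l a).map (pair a)).reverse := by
    refine (foldIdx (fun a => (l a).map (e₁ a)) (fun a j => .cons
      (.ofList (((l a).drop j).map (e₂ a))) (.ofList (((l a).take j).map (pair a)).reverse))
      (by simpa using hn) h₁ ((h₂.cons nil).congr fun a => by simp) ?_).snd.congr
      fun a => by simp
    refine (arg.snd.fst.tl.cons ((arg.fst.cons arg.snd.fst.hd).cons arg.snd.snd)).congr
      fun ⟨a, j⟩ => ?_
    have hj : (j : ℕ) < (l a).length := by simpa using j.isLt
    dsimp only
    rw [List.drop_eq_getElem_cons hj, List.take_succ_eq_append_getElem hj, List.map_append,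
      List.reverse_append]
    simp only [List.map_cons, BTree.ofList_cons, BTree.hd_cons, BTree.tl_cons, pair]
    simp
  exact (reversed.reverse _ (by simpa using hn)).congr fun a => by simp [pair]

/-! ### Unary numbers -/

theorem unary_length (L : α → List BTree) (hn : PolyBdd m fun a => (L a).length)
    (hL : PolyTime m i fun a => .ofList (L a)) :
    PolyTime m i fun a => .unary (L a).length :=
  foldIdx L (fun _ j => .unary j) hn hL nil (nil.cons arg.snd)

theorem unary_const (k : ℕ) : PolyTime m i fun _ => .unary k := by
  induction k with
  | zero => exact nil
  | succ k ih => exact nil.cons ih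

variable {u v : α → ℕ}

theorem iterate (acc : α → ℕ → BTree) (hn : PolyBdd m u) (hu : PolyTime m i fun a => .unary (u a))
    (h₀ : PolyTime m i fun a => acc a 0)
    (h : PolyTimeWith m i (fun a (j : Fin (u a)) => acc a j) fun a j => acc a (j + 1)) :
    PolyTime m i fun a => acc a (u a) :=
  (foldIdx (fun a => List.replicate (u a) .nil) acc (by simpa using hn) hu h₀
    (h.subst (fun p : Σ a, Fin (List.replicate (u a) BTree.nil).length => ⟨p.1, p.2.cast (by simp)⟩)
      arg.snd context)).congr fun a => by simp

theorem unary_add (hn : PolyBdd m u) (hu : PolyTime m i fun a => .unary (u a))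
    (hv : PolyTime m i fun a => .unary (v a)) : PolyTime m i fun a => .unary (v a + u a) :=
  iterate (fun a j => .unary (v a + j)) hn hu hv (nil.cons arg)

theorem unary_mul (hn : PolyBdd m u) (hn' : PolyBdd m v)
    (hu : PolyTime m i fun a => .unary (u a)) (hv : PolyTime m i fun a => .unary (v a)) :
    PolyTime m i fun a => .unary (v a * u a) :=
  iterate (fun a j => .unary (v a * j)) hn hu nil
    (unary_add (u := fun p : Σ a, Fin (u a) => v p.1) (hn'.reindex Sigma.fst)
      (context.comp (hv.reindex Sigma.fst)) arg)

theorem unary_pow (hn : PolyBdd m u) (hu : PolyTime m i fun a => .unary (u a)) (k : ℕ) :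
    PolyTime m i fun a => .unary (u a ^ k) := by
  induction k with
  | zero => exact (unary_const 1).congr fun a => by simp
  | succ k ih => exact unary_mul hn (hn.pow k) hu ih

theorem drop (L : α → List BTree) (hn : PolyBdd m u) (hu : PolyTime m i fun a => .unary (u a))
    (hL : PolyTime m i fun a => .ofList (L a)) :
    PolyTime m i fun a => .ofList ((L a).drop (u a)) :=
  iterate (fun a j => .ofList ((L a).drop j)) hn hu (hL.congr fun a => by simp)
    (arg.tl.congr fun p => by
      dsimp only
      rw [← List.drop_drop]
      cases (L p.1).drop p.2 <;> simp)

theorem head? {L : α → List BTree} (hL : PolyTime m i fun a => .ofList (L a)) :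
    PolyTime m i fun a => .ofOption _root_.id (L a).head? := by
  refine cases hL (((hL.hd.cons nil).reindex Subtype.val).congr fun ⟨a, ha⟩ => ?_)
    (nil.congr fun ⟨a, ha⟩ => ?_)
  · cases h : L a <;> simp_all
  · simp [BTree.ofList_eq_nil.1 ha]

theorem getElem? (L : α → List BTree) (hn : PolyBdd m u) (hu : PolyTime m i fun a => .unary (u a))
    (hL : PolyTime m i fun a => .ofList (L a)) :
    PolyTime m i fun a => .ofOption _root_.id (L a)[u a]? :=
  (drop L hn hu hL).head?.congr fun a => by rw [List.head?_drop]

theorem idMatrix (hn : PolyBdd m u) (hu : PolyTime m i fun a => .unary (u a)) :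
    PolyTime m i fun a => .ofList ((List.finRange (u a)).map fun x =>
      .ofList ((List.finRange (u a)).map fun y => .bit (y = x))) := by
  let row {j : ℕ} (x : Fin j) : BTree := .ofList ((List.finRange j).map fun y => .bit (y = x))
  refine (iterate (fun _ j => .cons (.unary j) (.ofList ((List.finRange j).map row))) hn hu
    (nil.cons nil) ?_).snd
  refine ((nil.cons arg.fst).cons (((nil.cons nil).cons arg.fst).cons
    (map (fun p : Σ a, Fin (u a) => List.finRange p.2) (fun _ => row)
      (fun _ x => .cons .nil (row x)) ((hn.reindex Sigma.fst).mono fun p => by simp) arg.snd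
      (nil.cons arg)))).congr fun p => ?_
  simp [row, List.finRange_succ, List.replicate_succ, Function.comp_def, BTree.unary,
    Fin.succ_ne_zero, (Fin.succ_ne_zero _).symm, List.map_const']

end PolyTime

/-! ### Enumeration by a loop -/

theorem Trace.le_length_outputs_take_append {w u : Trace} {D E K : ℕ} (hw : w.length ≤ D)
    (hK : D + E ≤ K) : (Trace.outputs w).length + (Trace.outputs (u.take E)).length ≤
      (Trace.outputs ((w ++ u).take K)).length := by
  rw [List.take_append, List.take_of_length_le (l := w) (by lia), Trace.outputs_append,
    List.length_append]
  exact Nat.add_le_add_left (Trace.length_outputs_take_mono u (by lia)) _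

/-- The loop that, as long as the state in variable `0` is not `nil`, outputs its head and runs
`c` to obtain the next state. -/
def Prog.emitLoop (c : Prog) : Prog := .while 0 (.seq (.hd 1 0) (.seq (.emit 1) c))

theorem Exec.emitLoop {c : Prog} {l : List BTree} {st : ℕ → BTree} {T : ℕ → ℕ} (hT : Monotone T)
    (hst : ∀ (j : ℕ) (hj : j < l.length), ∃ r, st j = .cons l[j] r) (hend : st l.length = .nil)
    (hc : ∀ j < l.length, ∀ σ : Store, σ 0 = st j →
      ∃ τ, SilentExec c σ (T j) τ ∧ τ 0 = st (j + 1))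
    (k j : ℕ) (hkj : k + j = l.length) (σ : Store) (hσ : σ 0 = st j) :
    ∃ t τ, Exec c.emitLoop σ t τ ∧ t.outputs = l.drop j ∧
      t.length ≤ k * (T l.length + 3) + 1 ∧
      ∀ s ≤ k, s ≤ (Trace.outputs (t.take (s * (T (j + s) + 3)))).length := by
  induction k generalizing j σ with
  | zero =>
    obtain rfl : j = l.length := by lia
    exact ⟨_, _, .whileFalse (by rw [hσ, hend]), by simp, by simp, by lia⟩
  | succ k ih =>
    have hj : j < l.length := by lia
    obtain ⟨r, hr⟩ := hst j hj
    obtain ⟨τ, ⟨t, e₁, o₁, l₁⟩, r₁⟩ := hc j hj (Function.update σ 1 (σ 0).hd) (by simpa using hσ)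
    obtain ⟨u, ρ, e₂, o₂, l₂, s₂⟩ := ih (j + 1) (by lia) τ r₁
    refine ⟨_, _, Exec.whileTrue (by simp [hσ, hr]) ((Exec.hd 1 0 σ).seq ((Exec.emit 1 _).seq e₁))
      e₂, ?_, ?_, fun s hs => ?_⟩
    · rw [List.drop_eq_getElem_cons hj]
      simp [o₁, o₂, hσ, hr]
    · have := hT hj.le
      simp only [List.length_append, List.length_cons, List.length_nil, add_mul]
      lia
    · cases s with
      | zero => lia
      | succ s =>
        have := hT (show j ≤ j + (s + 1) by lia)
        have rest := s₂ s (by lia)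
        rw [add_right_comm, add_assoc j] at rest
        rw [← List.cons_append]
        refine le_trans ?_ (Trace.le_length_outputs_take_append (D := T (j + (s + 1)) + 3)
          (E := s * (T (j + (s + 1)) + 3)) ?_ (by lia))
        · simp [o₁]
          lia
        · simp only [List.length_append, List.length_cons, List.length_nil]
          lia

/-- Some program outputs, on every input `i a`, the values in the list `l a`, where both the time
until the output of the `s`-th value and the total time are polynomial in `m a` and the number of
values output. -/
def IncrementallyEnumerable {α : Type*} (m : α → ℕ) (i : α → BTree) (l : α → List BTree) : Prop :=
  ∃ (c : Prog) (d : ℕ), ∀ a, ∃ t : Trace, (∃ τ, Exec c (initStore (i a)) t τ) ∧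
    t.outputs = l a ∧ t.length ≤ (m a + (l a).length + 2) ^ d ∧
    ∀ s ≤ (l a).length, s ≤ (Trace.outputs (t.take ((m a + s + 2) ^ d))).length

namespace PolyTime

variable {α : Type*} {m : α → ℕ} {i : α → BTree} {l : α → List BTree}

theorem incrementallyEnumerable_of_state (st : α → ℕ → BTree)
    (hst : ∀ a (j : ℕ) (hj : j < (l a).length), ∃ r, st a j = .cons (l a)[j] r)
    (hend : ∀ a, st a (l a).length = .nil) (h₀ : PolyTime m i fun a => st a 0)
    (h : PolyTime (fun p : Σ a, Fin (l a).length => m p.1 + p.2) (fun p => st p.1 p.2)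
      fun p => st p.1 (p.2 + 1)) :
    IncrementallyEnumerable m i l := by
  obtain ⟨c₀, T₀, ⟨d₀, hT₀⟩, hc₀⟩ := h₀
  obtain ⟨c, T, ⟨d, hT⟩, hc⟩ := h
  have hm : PolyBdd (fun p : α × ℕ => m p.1 + p.2) fun p => m p.1 :=
    (PolyBdd.self _).mono fun p => by simp
  have hs : PolyBdd (fun p : α × ℕ => m p.1 + p.2) fun p => p.2 :=
    (PolyBdd.self _).mono fun p => by simp
  obtain ⟨e, he⟩ := (((PolyBdd.base_pow m d₀).reindex Prod.fst).trans hm).add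
    ((hs.mul ((PolyBdd.base_pow _ d).add (.const _ 3))).add (.const _ 1))
  refine ⟨.seq c₀ c.emitLoop, e, fun a => ?_⟩
  obtain ⟨τ, ⟨t, e₁, o₁, l₁⟩, r₁⟩ := hc₀ a (initStore (i a)) rfl
  obtain ⟨u, ρ, e₂, o₂, l₂, s₂⟩ := Exec.emitLoop (T := fun j => (m a + j + 2) ^ d)
    (fun _ _ hjk => Nat.pow_le_pow_left (by lia) d) (hst a) (hend a)
    (fun j hj σ hσ => (hc ⟨a, j, hj⟩ σ hσ).imp fun _ hτ => ⟨hτ.1.mono (hT ⟨a, j, hj⟩), hτ.2⟩)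
    (l a).length 0 rfl τ r₁
  have ht := l₁.trans (hT₀ a)
  refine ⟨_, ⟨_, e₁.seq e₂⟩, by simp [o₁, o₂], ?_, fun s hs => ?_⟩
  · have := he (a, (l a).length)
    rw [List.length_append]
    lia
  · have := Trace.le_length_outputs_take_append (u := u) (E := s * ((m a + s + 2) ^ d + 3)) ht
      ((Nat.le_succ _).trans (he (a, s)))
    simpa [o₁] using (s₂ s hs).trans (by simpa [o₁] using this)

theorem incrementallyEnumerable
    (h : PolyTime (fun p : α × ℕ => m p.1 + p.2)
      (fun p => .cons (i p.1) (.ofList ((l p.1).take p.2).reverse))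
      fun p => .ofOption _root_.id (l p.1)[p.2]?) :
    IncrementallyEnumerable m i l := by
  let known (a : α) (j : ℕ) : BTree := .cons (i a) (.ofList ((l a).take j).reverse)
  let st (a : α) (j : ℕ) : BTree := (l a)[j]?.elim .nil fun v => .cons v (known a j)
  have st_of_known : PolyTime (fun p : α × ℕ => m p.1 + p.2) (fun p => known p.1 p.2)
      fun p => st p.1 p.2 := by
    refine cases h (((h.hd.cons (.id _ _)).reindex Subtype.val).congr fun ⟨p, hp⟩ => ?_)
      (nil.congr fun ⟨p, hp⟩ => ?_)
    · cases hv : (l p.1)[p.2]? with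
      | none => simp [hv] at hp
      | some v => simp [st, known, hv]
    · cases hv : (l p.1)[p.2]? with
      | none => simp [st, hv]
      | some v => simp [hv] at hp
  have st_eq (a : α) (j : ℕ) (hj : j < (l a).length) : st a j = .cons (l a)[j] (known a j) := by
    simp [st, hj]
  refine incrementallyEnumerable_of_state st (fun a j hj => ⟨_, st_eq a j hj⟩)
    (fun a => by simp [st])
    (((PolyTime.id m i).cons nil).comp (st_of_known.reindex fun a => (a, 0))) ?_
  have split : PolyTime (fun p : Σ a, Fin (l a).length => m p.1 + p.2) (fun p => st p.1 p.2)
      fun p => .cons (l p.1)[p.2] (known p.1 p.2) :=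
    (PolyTime.id _ _).congr fun p => st_eq p.1 p.2 p.2.isLt
  have known_succ : PolyTime (fun p : Σ a, Fin (l a).length => m p.1 + p.2)
      (fun p => st p.1 p.2) fun p => known p.1 (p.2 + 1) :=
    (split.snd.fst.cons (split.fst.cons split.snd.snd)).congr fun p => by
      simp only [known]
      rw [List.take_succ_eq_append_getElem p.2.isLt, List.reverse_append]
      rfl
  exact known_succ.comp ((st_of_known.reindex fun p : Σ a, Fin (l a).length =>
    (p.1, (p.2 + 1 : ℕ))).measure (((PolyBdd.self _).add (.const _ 1)).mono fun p => by lia))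

end PolyTime

/-! ### Encodings -/

theorem encodeVertexSet_eq {n : ℕ} (U : Finset (Fin n)) :
    encodeVertexSet U = .ofList ((List.finRange n).map fun x => .bit (x ∈ U)) := by
  rw [encodeVertexSet, List.ofFn_eq_map]

theorem encodeGraph_eq {n : ℕ} (G : SimpleGraph (Fin n)) :
    encodeGraph G = .ofList ((List.finRange n).map fun x =>
      .ofList ((List.finRange n).map fun y => .bit (G.Adj x y))) := by
  simp only [encodeGraph, List.ofFn_eq_map]

theorem PolyTime.unary_order {α : Type*} {m : α → ℕ} {i : α → BTree} {n : α → ℕ}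
    {G : ∀ a, SimpleGraph (Fin (n a))} (hn : PolyBdd m n)
    (hG : PolyTime m i fun a => encodeGraph (G a)) : PolyTime m i fun a => .unary (n a) :=
  (unary_length (fun a => (List.finRange (n a)).map fun x =>
    .ofList ((List.finRange (n a)).map fun y => .bit ((G a).Adj x y))) (by simpa using hn)
    (hG.congr fun a => encodeGraph_eq (G a))).congr fun a => by simp

theorem encodeVertexSet_injective {n : ℕ} :
    Function.Injective (encodeVertexSet : Finset (Fin n) → BTree) := by
  intro U W h
  have h' := List.ofFn_injective (BTree.ofList_injective h)
  ext x
  exact BTree.bit_inj.1 (congrFun h' x)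

theorem enumeratesOn_iff {P : GraphClass} {c : Prog} {n : ℕ} {G : SimpleGraph (Fin n)}
    {t : Trace} : EnumeratesOn P c G t ↔ (∃ τ, Exec c (initStore (encodeGraph G)) t τ) ∧
      ∃ l : List (Finset (Fin n)), l.Nodup ∧ (∀ U, U ∈ l ↔ U ∈ maxConnectedPSets P G) ∧
        t.outputs = l.map encodeVertexSet := by
  refine and_congr_right fun _ => ⟨fun ⟨hnd, hmem⟩ => ?_, fun ⟨l, hnd, hmem, ho⟩ => ?_⟩
  · obtain ⟨l, hl⟩ : t.outputs ∈ Set.range (List.map (encodeVertexSet (n := n))) := by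
      rw [Set.range_list_map]
      exact fun v hv => ((hmem v).1 hv).imp fun _ hU => hU.2
    rw [← hl] at hnd hmem
    exact ⟨l, hnd.of_map, fun U => by
      simpa [encodeVertexSet_injective.eq_iff] using hmem (encodeVertexSet U), hl.symm⟩
  · rw [ho]
    exact ⟨hnd.map encodeVertexSet_injective, fun v => by simp [hmem]⟩

theorem length_eq_ncard_of_nodup {β : Type*} {l : List β} {S : Set β} (hl : l.Nodup)
    (h : ∀ b, b ∈ l ↔ b ∈ S) : l.length = S.ncard := by
  classical
  have hS : S = l.toFinset := by ext b; simp [h]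
  rw [hS, Set.ncard_coe_finset, List.toFinset_card_of_nodup hl]

theorem EnumeratesOn.length_outputs {P : GraphClass} {c : Prog} {n : ℕ}
    {G : SimpleGraph (Fin n)} {t : Trace} (h : EnumeratesOn P c G t) :
    t.outputs.length = (maxConnectedPSets P G).ncard := by
  obtain ⟨-, l, hnd, hmem, ho⟩ := enumeratesOn_iff.1 h
  rw [ho, List.length_map, length_eq_ncard_of_nodup hnd hmem]

/-! ### From incremental polynomial time to polynomial total time -/

open PolyTimeWith in
theorem PolyTime.outputs_of_incremental {α : Type*} {k : α → ℕ} {v : α → BTree} {c : Prog}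
    {tr : α → Trace} {d : ℕ} (htr : ∀ a, ∃ τ, Exec c (initStore (v a)) (tr a) τ)
    (hinc : ∀ a, ∀ s ≤ (tr a).outputs.length,
      s ≤ (Trace.outputs ((tr a).take ((k a + s + 2) ^ d))).length)
    (hk : PolyTime k v fun a => .unary (k a)) :
    PolyTime (fun a => k a + (tr a).outputs.length) v fun a => .ofList (tr a).outputs.reverse := by
  let N (a : α) : ℕ := (tr a).outputs.length
  let m (a : α) : ℕ := k a + N a
  let found (a : α) (s : ℕ) : List BTree :=
    (Trace.outputs ((tr a).take ((k a + s + 3) ^ d))).reverse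
  let st (a : α) (s : ℕ) : BTree :=
    .cons (.ofList ((found a s).drop s)) (.cons (.unary s) (.cons (.ofList (found a s)) (v a)))
  have found_le (a : α) (s : ℕ) : (found a s).length ≤ N a := by
    simpa [found] using (Trace.outputs_take_prefix_outputs (tr a) _).length_le
  have le_found (a : α) (s : ℕ) (hs : s ≤ N a) : s ≤ (found a s).length := by
    simpa [found] using (hinc a s hs).trans
      (Trace.length_outputs_take_mono _ (Nat.pow_le_pow_left (by lia) d))
  have lt_found (a : α) (s : ℕ) (hs : s < N a) : s < (found a s).length := by
    simpa [found, add_assoc, add_comm 1] using hinc a (s + 1) hs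
  have hkN : PolyBdd m k := (PolyBdd.self _).mono fun a => by simp [m]
  have st_poly : PolyTimeWith m v (fun a (s : Fin (N a + 1)) => .unary s) fun a s => st a s := by
    have hs : PolyBdd (fun p : Σ a, Fin (N a + 1) => m p.1) fun p => p.2 :=
      (PolyBdd.self _).mono fun p => by have := p.2.isLt; simp only [m]; lia
    have clock := (unary_add (.const _ 3) (unary_const 3) (unary_add hs arg
      (context.comp ((hk.measure hkN).reindex Sigma.fst)))).unary_pow
      (((hkN.reindex Sigma.fst).add hs).add (.const _ 3)) d
    have run := (simulate c (fun p : Σ a, Fin (N a + 1) => htr p.1)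
      ((((hkN.reindex Sigma.fst).add hs).add (.const _ 3)).pow d) context clock).fst
    exact (drop (fun p => found p.1 p.2) hs arg run).cons (arg.cons (run.cons context))
  have final : PolyTime m v fun a => .ofList (found a (N a)) := by
    have start : PolyTime m v fun a => st a 0 :=
      (nil.cons (.id _ _)).comp (st_poly.reindex fun a => (⟨a, 0⟩ : Σ a, Fin (N a + 1)))
    have step : PolyTime (fun p : Σ a, Fin (N a) => m p.1) (fun p => st p.1 p.2)
        fun p => st p.1 (p.2 + 1) :=
      ((nil.cons context.fst).cons context.snd.snd).comp
        (st_poly.reindex fun p : Σ a, Fin (N a) => (⟨p.1, p.2.succ⟩ : Σ a, Fin (N a + 1)))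
    refine (start.comp
      (loop st ((PolyBdd.self _).mono fun a => by simp [m]) ?_ ?_ step)).snd.snd.fst
    · exact fun a s hs => by simpa [st] using lt_found a s hs
    · exact fun a => by simpa [st] using found_le a (N a)
  refine final.congr fun a => ?_
  have complete := le_found a (N a) le_rfl
  rw [List.length_reverse] at complete
  simp only [found, (Trace.outputs_take_prefix_outputs (tr a) _).eq_of_length_le complete]

theorem PolyTime.incrementallyEnumerable_of_ofList {α : Type*} {m : α → ℕ} {i : α → BTree}
    {l : α → List BTree} (h : PolyTime m i fun a => .ofList (l a)) :
    IncrementallyEnumerable m i l := by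
  have hm : PolyBdd (fun p : α × ℕ => m p.1 + p.2) fun p => m p.1 :=
    (PolyBdd.self _).mono fun p => by simp
  have hlen : PolyBdd (fun p : α × ℕ => m p.1 + p.2) fun p => ((l p.1).take p.2).reverse.length :=
    (PolyBdd.self _).mono fun p => by simp
  refine incrementallyEnumerable ((getElem? (fun p => l p.1) hlen
    (unary_length _ hlen PolyTimeWith.context)
    (PolyTimeWith.arg.comp ((h.reindex Prod.fst).measure hm))).congr fun p => ?_)
  rcases le_total p.2 (l p.1).length with hp | hp <;> simp [hp]

theorem SolvableInIncrementalPolyTime.solvableInPolyTotalTime {P : GraphClass}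
    (h : SolvableInIncrementalPolyTime P) : SolvableInPolyTotalTime P := by
  obtain ⟨c, p, h⟩ := h
  obtain ⟨d, hd⟩ := polyBdd_eval p
  choose tr henum hinc using h
  let l (a : Σ n, SimpleGraph (Fin n)) : List BTree := (tr a.1 a.2).outputs.reverse
  have length_l (a) : (l a).length = (maxConnectedPSets P a.2).ncard := by
    rw [List.length_reverse, (henum a.1 a.2).length_outputs]
  have hinc' (a : Σ n, SimpleGraph (Fin n)) (s : ℕ) (hs : s ≤ (tr a.1 a.2).outputs.length) :
      s ≤ (Trace.outputs ((tr a.1 a.2).take ((a.1 + s + 2) ^ d))).length := by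
    rcases s.eq_zero_or_pos with rfl | hpos
    · exact Nat.zero_le _
    · exact (hinc a.1 a.2 s hpos ((henum a.1 a.2).length_outputs ▸ hs)).trans
        (Trace.length_outputs_take_mono _ (by simpa using hd ![a.1, s]))
  obtain ⟨c', e, hc'⟩ := PolyTime.incrementallyEnumerable_of_ofList (l := l)
    (PolyTime.outputs_of_incremental (fun a => (henum a.1 a.2).1) hinc'
      (.unary_order (.self _) (.id _ _)))
  refine ⟨c', (.X 0 + .X 1 + .X 1 + .C 2) ^ e, fun n G => ?_⟩
  obtain ⟨t, ht, ho, hl, -⟩ := hc' ⟨n, G⟩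
  refine ⟨t, ⟨ht, ?_, fun v => ?_⟩, ?_⟩
  · rw [ho]; exact List.nodup_reverse.2 (henum n G).2.1
  · rw [ho, List.mem_reverse, (henum n G).2.2 v]
  · simpa [length_l, (henum n G).length_outputs] using hl

/-! ### Greedy optimization of a set -/

theorem isFixedPt_iterate_card {α : Type*} [Fintype α] {f : Finset α → Finset α} (hf : ∀ K, K ⊆ f K)
    (K : Finset α) : Function.IsFixedPt f (f^[Fintype.card α] K) := by
  have fixed_or_le_card (k : ℕ) : Function.IsFixedPt f (f^[k] K) ∨ k ≤ (f^[k] K).card := by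
    induction k with
    | zero => exact .inr (Nat.zero_le _)
    | succ k ih =>
      rw [Function.iterate_succ_apply']
      by_cases h : f (f^[k] K) = f^[k] K
      · exact .inl (congrArg f h)
      · exact .inr ((ih.resolve_left h).trans_lt
          (Finset.card_lt_card ((hf _).ssubset_of_ne (Ne.symm h))))
  rcases fixed_or_le_card (Fintype.card α) with h | h
  · exact h
  · rw [Finset.eq_univ_of_card _ ((Finset.card_le_univ _).antisymm h)]
    exact Finset.univ_subset_iff.1 (hf _)

section Greedy

variable {α : Type*} [DecidableEq α] {Q Q' : Finset α → Prop} [DecidablePred Q]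
  [DecidablePred Q'] {l : List α} {K : Finset α} {u : α}

/-- The elements of `l` are considered one by one and removed from `K` if `Q` still holds
afterwards. -/
def greedyErase (Q : Finset α → Prop) [DecidablePred Q] (l : List α) (K : Finset α) : Finset α :=
  l.foldl (fun K u => if Q (K.erase u) then K.erase u else K) K

/-- The elements of `l` are considered one by one and added to `K` if `Q` still holds
afterwards. -/
def greedyInsert (Q : Finset α → Prop) [DecidablePred Q] (l : List α) (K : Finset α) :
    Finset α :=
  l.foldl (fun K u => if Q (insert u K) then insert u K else K) K

theorem greedyErase_cons (Q : Finset α → Prop) [DecidablePred Q] (u : α) (l : List α)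
    (K : Finset α) : greedyErase Q (u :: l) K =
      greedyErase Q l (if Q (K.erase u) then K.erase u else K) := rfl

theorem greedyInsert_cons (Q : Finset α → Prop) [DecidablePred Q] (u : α) (l : List α)
    (K : Finset α) : greedyInsert Q (u :: l) K =
      greedyInsert Q l (if Q (insert u K) then insert u K else K) := rfl

theorem greedyErase_subset : greedyErase Q l K ⊆ K := by
  induction l generalizing K with
  | nil => exact Finset.Subset.refl K
  | cons u l ih =>
    rw [greedyErase_cons]
    split_ifs
    exacts [ih.trans (Finset.erase_subset u K), ih]

theorem prop_greedyErase (h : Q K) : Q (greedyErase Q l K) := by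
  induction l generalizing K with
  | nil => exact h
  | cons u l ih =>
    rw [greedyErase_cons]
    split_ifs with hu
    exacts [ih hu, ih h]

theorem greedyErase_congr (h : ∀ K' ⊆ K, Q K' ↔ Q' K') :
    greedyErase Q l K = greedyErase Q' l K := by
  induction l generalizing K with
  | nil => rfl
  | cons u l ih =>
    have hu := h _ (Finset.erase_subset u K)
    simp only [greedyErase_cons, hu]
    split_ifs
    · exact ih fun K' hK' => h K' (hK'.trans (Finset.erase_subset u K))
    · exact ih h

theorem not_prop_erase_greedyErase (hQ : ∀ ⦃K K'⦄, K ⊆ K' → Q K → Q K') (hul : u ∈ l)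
    (hu : u ∈ greedyErase Q l K) : ¬ Q ((greedyErase Q l K).erase u) := by
  induction l generalizing K with
  | nil => simp at hul
  | cons w l ih =>
    rw [greedyErase_cons] at hu ⊢
    rcases List.mem_cons.1 hul with rfl | hul
    · split_ifs at hu with hw
      · exact absurd (greedyErase_subset hu) (Finset.notMem_erase _ _)
      · rw [if_neg hw]
        exact fun h => hw (hQ (Finset.erase_subset_erase _ greedyErase_subset) h)
    · exact ih hul hu

theorem minimal_greedyErase (hQ : ∀ ⦃K K'⦄, K ⊆ K' → Q K → Q K') (hl : ∀ u, u ∈ l) (h : Q K) :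
    Minimal Q (greedyErase Q l K) := by
  refine ⟨prop_greedyErase h, fun T hT hle u hu => ?_⟩
  by_contra huT
  exact not_prop_erase_greedyErase hQ (hl u) hu (hQ (Finset.subset_erase.2 ⟨hle, huT⟩) hT)

theorem subset_greedyInsert : K ⊆ greedyInsert Q l K := by
  induction l generalizing K with
  | nil => exact Finset.Subset.refl K
  | cons u l ih =>
    rw [greedyInsert_cons]
    split_ifs
    exacts [(Finset.subset_insert u K).trans ih, ih]

theorem prop_greedyInsert (h : Q K) : Q (greedyInsert Q l K) := by
  induction l generalizing K with
  | nil => exact h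
  | cons u l ih =>
    rw [greedyInsert_cons]
    split_ifs with hu
    exacts [ih hu, ih h]

theorem mem_of_greedyInsert_eq_self (h : greedyInsert Q l K = K) (hul : u ∈ l)
    (hu : Q (insert u K)) : u ∈ K := by
  induction l generalizing K with
  | nil => simp at hul
  | cons w l ih =>
    rw [greedyInsert_cons] at h
    split_ifs at h with hw
    · have hwK : w ∈ K := h.subset (subset_greedyInsert (Finset.mem_insert_self w K))
      rw [Finset.insert_eq_of_mem hwK] at h
      rcases List.mem_cons.1 hul with rfl | hul
      exacts [hwK, ih h hul hu]
    · rcases List.mem_cons.1 hul with rfl | hul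
      exacts [absurd hu hw, ih h hul hu]

-- One pass need not suffice: an element rejected early may be admissible after later additions.
theorem maximal_iterate_greedyInsert [Fintype α]
    (hQ : ∀ ⦃K T⦄, Q K → Q T → K ⊂ T → ∃ u, u ∉ K ∧ Q (insert u K)) (hl : ∀ u, u ∈ l) (h : Q K) :
    Maximal Q ((greedyInsert Q l)^[Fintype.card α] K) := by
  have hmax : Q ((greedyInsert Q l)^[Fintype.card α] K) :=
    Function.Iterate.rec Q h (fun _ => prop_greedyInsert) _
  refine ⟨hmax, fun T hT hle => ?_⟩
  by_contra hlt
  obtain ⟨u, hu, hQu⟩ := hQ hmax hT ⟨hle, hlt⟩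
  exact hu (mem_of_greedyInsert_eq_self (isFixedPt_iterate_card (fun _ => subset_greedyInsert) K)
    (hl u) hQu)

theorem subset_iterate_greedyInsert (k : ℕ) : K ⊆ (greedyInsert Q l)^[k] K :=
  Function.id_le_iterate_of_id_le (fun _ => subset_greedyInsert) k K

end Greedy

/-! ### Connected sets of a hereditary class -/

namespace IsConnectedPSet

variable {P : GraphClass} {n : ℕ} {G : SimpleGraph (Fin n)} {C T U W X : Finset (Fin n)}

theorem nonempty (h : IsConnectedPSet P G U) : U.Nonempty := by
  obtain ⟨x⟩ := h.1.nonempty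
  exact ⟨x.1, x.2⟩

theorem of_subset (hP : P.Hereditary) (hU : IsConnectedPSet P G U) (hW : W ⊆ U)
    (hc : (G.induce (W : Set (Fin n))).Connected) : IsConnectedPSet P G W := by
  refine ⟨hc, ?_⟩
  obtain ⟨x⟩ := hc.nonempty
  refine P.iso_closed ⟨?_⟩ (hP _ hU.2 {y : (U : Set (Fin n)) | y.1 ∈ W} ⟨⟨x.1, hW x.2⟩, x.2⟩)
  exact {
    toFun := fun y => ⟨y.1.1, y.2⟩
    invFun := fun y => ⟨⟨y.1, hW y.2⟩, y.2⟩
    left_inv := fun _ => rfl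
    right_inv := fun _ => rfl
    map_rel_iff' := Iff.rfl }

theorem singleton (hP : P.Hereditary) (G : SimpleGraph (Fin n)) (v : Fin n) :
    IsConnectedPSet P G {v} := by
  obtain ⟨k, H, hk, hH⟩ := P.nonempty
  have mem_singleton := hP H hH {⟨0, hk⟩} ⟨_, rfl⟩
  have : Unique ((({v} : Finset (Fin n)) : Set (Fin n))) :=
    ⟨⟨⟨v, by simp⟩⟩, fun x => Subtype.ext (by simpa using x.2)⟩
  constructor
  · exact (SimpleGraph.connected_iff _).2
      ⟨SimpleGraph.Preconnected.of_subsingleton, inferInstance⟩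
  · refine P.iso_closed ⟨⟨Equiv.ofUnique _ _, fun {a b} => ?_⟩⟩ mem_singleton
    rw [Subsingleton.elim a b]
    simp

theorem union (hP : P.Hereditary) (hX : IsConnectedPSet P G X) (hW : IsConnectedPSet P G W)
    (hne : (X ∩ W).Nonempty) (hU : IsConnectedPSet P G U) (hXU : X ⊆ U) (hWU : W ⊆ U) :
    IsConnectedPSet P G (X ∪ W) := by
  refine hU.of_subset hP (Finset.union_subset hXU hWU) ?_
  rw [Finset.coe_union]
  refine SimpleGraph.induce_union_connected hX.1.preconnected hW.1.preconnected ?_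
  rw [← Finset.coe_inter]
  exact_mod_cast hne

theorem exists_insert (hP : P.Hereditary) (hT : IsConnectedPSet P G T)
    (hC : IsConnectedPSet P G C) (hCT : C ⊂ T) :
    ∃ v ∈ T, v ∉ C ∧ IsConnectedPSet P G (insert v C) := by
  obtain ⟨u, hu⟩ := hC.nonempty
  obtain ⟨w, hwT, hwC⟩ := Finset.exists_of_ssubset hCT
  obtain ⟨p⟩ := hT.1.preconnected ⟨u, hCT.subset hu⟩ ⟨w, hwT⟩
  obtain ⟨d, -, h₁, h₂⟩ := p.exists_boundary_dart {x | x.1 ∈ C} hu hwC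
  refine ⟨d.snd.1, d.snd.2, h₂, hT.of_subset hP (Finset.insert_subset d.snd.2 hCT.subset) ?_⟩
  rw [Finset.coe_insert, ← Set.union_singleton]
  exact SimpleGraph.connected_induce_union hC.1.preconnected
    SimpleGraph.Preconnected.of_subsingleton h₁ rfl d.adj

end IsConnectedPSet

/-! ### Isolating the vertices outside a set -/

section EdgesWithin

variable {P : GraphClass} {n : ℕ} {G : SimpleGraph (Fin n)} {K U X Y : Finset (Fin n)}
  {x y : Fin n}

/-- The subgraph of `G` on all vertices whose edges are those inside `K`. It replaces the induced
subgraph `G[K]` as input of a program, since its vertices need not be renumbered; the price is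
that every vertex outside `K` becomes a component of its own. -/
def edgesWithin (G : SimpleGraph (Fin n)) (K : Finset (Fin n)) : SimpleGraph (Fin n) :=
  (G.induce (K : Set (Fin n))).spanningCoe

theorem edgesWithin_adj : (edgesWithin G K).Adj x y ↔ x ∈ K ∧ y ∈ K ∧ G.Adj x y := by
  simp only [edgesWithin, SimpleGraph.map_adj, SimpleGraph.comap_adj,
    Function.Embedding.subtype_apply, Subtype.exists]
  grind

theorem induce_edgesWithin (h : X ⊆ K) :
    (edgesWithin G K).induce (X : Set (Fin n)) = G.induce (X : Set (Fin n)) := by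
  ext x y
  simp [edgesWithin_adj, h x.2, h y.2]

theorem subset_or_eq_singleton_of_connected
    (h : ((edgesWithin G K).induce (X : Set (Fin n))).Connected) : X ⊆ K ∨ ∃ x, X = {x} := by
  refine or_iff_not_imp_left.2 fun hXK => ?_
  obtain ⟨x, hx, hxK⟩ := Finset.not_subset.1 hXK
  refine ⟨x, Finset.eq_singleton_iff_unique_mem.2 ⟨hx, fun y hy => ?_⟩⟩
  by_contra hyx
  have : Nontrivial (X : Set (Fin n)) := ⟨⟨y, hy⟩, ⟨x, hx⟩, by simpa using hyx⟩
  obtain ⟨z, hz⟩ := h.preconnected.exists_adj_of_nontrivial ⟨x, hx⟩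
  exact hxK (edgesWithin_adj.1 hz).1

theorem isConnectedPSet_edgesWithin (hP : P.Hereditary) :
    IsConnectedPSet P (edgesWithin G K) X ↔ (IsConnectedPSet P G X ∧ X ⊆ K) ∨ ∃ x, X = {x} := by
  constructor
  · refine fun h => (subset_or_eq_singleton_of_connected h.1).imp_left fun hXK => ⟨?_, hXK⟩
    rwa [IsConnectedPSet, induce_edgesWithin hXK] at h
  · rintro (⟨h, hXK⟩ | ⟨x, rfl⟩)
    · rwa [IsConnectedPSet, induce_edgesWithin hXK]
    · exact .singleton hP _ x

theorem eq_of_mem_maxConnectedPSets_edgesWithin (hP : P.Hereditary)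
    (hX : X ∈ maxConnectedPSets P (edgesWithin G K))
    (hY : Y ∈ maxConnectedPSets P (edgesWithin G K)) (hxX : x ∈ X) (hxY : x ∈ Y)
    (h : X = {x} ∨ Y = {x} ∨ ∃ U, IsConnectedPSet P G U ∧ X ⊆ U ∧ Y ⊆ U) : X = Y := by
  have hX' : Maximal (IsConnectedPSet P (edgesWithin G K)) X := hX
  have hY' : Maximal (IsConnectedPSet P (edgesWithin G K)) Y := hY
  rcases h with rfl | rfl | ⟨U, hU, hXU, hYU⟩
  · exact hX'.eq_of_le hY'.prop (Finset.singleton_subset_iff.2 hxY)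
  · exact (hY'.eq_of_le hX'.prop (Finset.singleton_subset_iff.2 hxX)).symm
  rcases (isConnectedPSet_edgesWithin hP).1 hX'.prop with ⟨hcX, hXK⟩ | ⟨z, rfl⟩
  · rcases (isConnectedPSet_edgesWithin hP).1 hY'.prop with ⟨hcY, hYK⟩ | ⟨z, rfl⟩
    · have hunion : IsConnectedPSet P (edgesWithin G K) (X ∪ Y) :=
        (isConnectedPSet_edgesWithin hP).2 (.inl ⟨hcX.union hP hcY
          ⟨x, Finset.mem_inter.2 ⟨hxX, hxY⟩⟩ hU hXU hYU, Finset.union_subset hXK hYK⟩)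
      exact (hX'.eq_of_le hunion Finset.subset_union_left).trans
        (hY'.eq_of_le hunion Finset.subset_union_right).symm
    · rw [Finset.mem_singleton.1 hxY] at hxX
      exact (hY'.eq_of_le hX'.prop (Finset.singleton_subset_iff.2 hxX)).symm
  · rw [Finset.mem_singleton.1 hxX] at hxY
    exact hX'.eq_of_le hY'.prop (Finset.singleton_subset_iff.2 hxY)

end EdgesWithin

/-! ### Connected sets not covered by known solutions -/

section HasUncovered

variable {P : GraphClass} {n : ℕ} {G : SimpleGraph (Fin n)} {L : List (Finset (Fin n))}
  {K K' T U X : Finset (Fin n)} {v : Fin n}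

/-- Some connected `P` set of `G` inside `K` is contained in no member of `L`. -/
def HasUncovered (P : GraphClass) {n : ℕ} (G : SimpleGraph (Fin n)) (L : List (Finset (Fin n)))
    (K : Finset (Fin n)) : Prop :=
  ∃ X, IsConnectedPSet P G X ∧ X ⊆ K ∧ ∀ U ∈ L, ¬ X ⊆ U

theorem HasUncovered.mono (h : HasUncovered P G L K) (hK : K ⊆ K') : HasUncovered P G L K' :=
  h.imp fun _ hX => ⟨hX.1, hX.2.1.trans hK, hX.2.2⟩

theorem exists_superset_of_not_hasUncovered (h : ¬ HasUncovered P G L K)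
    (hX : IsConnectedPSet P G X) (hXK : X ⊆ K) : ∃ U ∈ L, X ⊆ U := by
  by_contra! hXL
  exact h ⟨X, hX, hXK, hXL⟩

theorem prop_of_minimal_hasUncovered (h : Minimal (HasUncovered P G L) K) :
    IsConnectedPSet P G K ∧ ∀ U ∈ L, ¬ K ⊆ U := by
  obtain ⟨X, hX, hXK, hXL⟩ := h.prop
  obtain rfl : K = X := h.eq_of_ge ⟨X, hX, subset_rfl, hXL⟩ hXK
  exact ⟨hX, hXL⟩

theorem ncard_maxConnectedPSets_edgesWithin_le (hP : P.Hereditary)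
    (hL : ∀ U ∈ L, IsConnectedPSet P G U) (hU : U ∈ ∅ :: L) (hK : K ⊆ insert v U)
    (h : ¬ HasUncovered P G L K) :
    (maxConnectedPSets P (edgesWithin G K)).ncard ≤ L.length + n := by
  classical
  let covers (X : Finset (Fin n)) : Finset (Fin n) ⊕ Fin n → Prop
    | .inl W => v ∈ X ∧ X ⊆ W
    | .inr x => x ∈ X ∧ (X = {x} ∨ X ⊆ U)
  have exists_covers : ∀ X ∈ (Set.toFinite (maxConnectedPSets P (edgesWithin G K))).toFinset,
      ∃ s ∈ L.toFinset.disjSum Finset.univ, covers X s := by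
    simp only [Set.Finite.mem_toFinset]
    intro X hX
    obtain ⟨y, hy⟩ := (show Maximal _ X from hX).prop.nonempty
    rcases (isConnectedPSet_edgesWithin hP).1 (show Maximal _ X from hX).prop with
      ⟨hc, hXK⟩ | ⟨x, rfl⟩
    · by_cases hv : v ∈ X
      · obtain ⟨W, hW, hXW⟩ := exists_superset_of_not_hasUncovered h hc hXK
        exact ⟨.inl W, by simpa using hW, hv, hXW⟩
      · exact ⟨.inr y, by simp, hy,
          .inr ((Finset.subset_insert_iff_of_notMem hv).1 (hXK.trans hK))⟩
    · exact ⟨.inr x, by simp, by simp, .inl rfl⟩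
  have covers_unique : ∀ s ∈ L.toFinset.disjSum Finset.univ,
      ({X ∈ (Set.toFinite (maxConnectedPSets P (edgesWithin G K))).toFinset | covers X s} :
        Set (Finset (Fin n))).Subsingleton := by
    rintro (W | x) hs X ⟨hX, hcX⟩ Y ⟨hY, hcY⟩ <;>
      simp only [Set.Finite.mem_toFinset] at hX hY
    · exact eq_of_mem_maxConnectedPSets_edgesWithin hP hX hY hcX.1 hcY.1
        (.inr (.inr ⟨W, hL W (by simpa using hs), hcX.2, hcY.2⟩))
    · refine eq_of_mem_maxConnectedPSets_edgesWithin hP hX hY hcX.1 hcY.1 ?_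
      rcases hcX.2 with hx | hXU
      · exact .inl hx
      rcases hcY.2 with hy | hYU
      · exact .inr (.inl hy)
      rcases List.mem_cons.1 hU with rfl | hU
      · exact absurd (hXU hcX.1) (Finset.notMem_empty x)
      · exact .inr (.inr ⟨U, hL U hU, hXU, hYU⟩)
  rw [Set.ncard_eq_toFinset_card]
  calc _ ≤ (L.toFinset.disjSum (Finset.univ : Finset (Fin n))).card :=
        Finset.card_le_card_of_forall_subsingleton covers exists_covers covers_unique
    _ ≤ L.length + n := by simpa using L.toFinset_card_le

theorem exists_hasUncovered_insert (hP : P.Hereditary) (hL : ∀ U ∈ L, U ∈ maxConnectedPSets P G)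
    (hT : T ∈ maxConnectedPSets P G) (hTL : T ∉ L) :
    ∃ U ∈ ∅ :: L, ∃ v, HasUncovered P G L (insert v U) := by
  have hT' : Maximal (IsConnectedPSet P G) T := hT
  obtain ⟨C, -, ⟨⟨hC, hCT, U, hU, hCU⟩, hmax⟩⟩ := (Set.toFinite {C | (C = ∅ ∨
    IsConnectedPSet P G C) ∧ C ⊆ T ∧ ∃ U ∈ ∅ :: L, C ⊆ U}).exists_le_maximal
      (a := ∅) ⟨.inl rfl, T.empty_subset, ∅, by simp, subset_rfl⟩
  have hne : C ≠ T := by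
    rintro rfl
    rcases List.mem_cons.1 hU with rfl | hU
    · exact hT'.prop.nonempty.ne_empty (Finset.subset_empty.1 hCU)
    · exact hTL (hT'.eq_of_le (show Maximal _ U from hL U hU).prop hCU ▸ hU)
  obtain ⟨v, hvT, hvC, hins⟩ : ∃ v ∈ T, v ∉ C ∧ IsConnectedPSet P G (insert v C) := by
    rcases hC with rfl | hC
    · obtain ⟨v, hv⟩ := hT'.prop.nonempty
      exact ⟨v, hv, by simp, .singleton hP G v⟩
    · exact hT'.prop.exists_insert hP hC (hCT.ssubset_of_ne hne)
  refine ⟨U, hU, v, insert v C, hins, Finset.insert_subset_insert v hCU, fun W hW hsub => hvC ?_⟩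
  exact hmax ⟨.inr hins, Finset.insert_subset hvT hCT, W, List.mem_cons_of_mem _ hW, hsub⟩
    (Finset.subset_insert v C) (Finset.mem_insert_self v C)

end HasUncovered

/-! ### A new solution from the known ones -/

/-- A program solving the problem for `P` in polynomial total time, together with its trace and
the list of solutions it outputs on every graph, and the degree of a time bound. -/
structure Enumerator (P : GraphClass) where
  prog : Prog
  deg : ℕ
  trace : ∀ {n : ℕ}, SimpleGraph (Fin n) → Trace
  solutions : ∀ {n : ℕ}, SimpleGraph (Fin n) → List (Finset (Fin n))
  exec : ∀ {n : ℕ} (G : SimpleGraph (Fin n)), ∃ τ, Exec prog (initStore (encodeGraph G)) (trace G) τ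
  outputs_trace : ∀ {n : ℕ} (G : SimpleGraph (Fin n)),
    (trace G).outputs = (solutions G).map encodeVertexSet
  mem_solutions : ∀ {n : ℕ} {G : SimpleGraph (Fin n)} {U : Finset (Fin n)},
    U ∈ solutions G ↔ U ∈ maxConnectedPSets P G
  length_trace_lt : ∀ {n : ℕ} (G : SimpleGraph (Fin n)),
    (trace G).length < (n + (maxConnectedPSets P G).ncard + 2) ^ deg

theorem SolvableInPolyTotalTime.nonempty_enumerator {P : GraphClass}
    (h : SolvableInPolyTotalTime P) : Nonempty (Enumerator P) := by
  obtain ⟨c, p, h⟩ := h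
  obtain ⟨d, hd⟩ := polyBdd_eval p
  choose tr htr hlen using h
  choose hexec l _ hmem hout using fun n G => enumeratesOn_iff.1 (htr n G)
  refine ⟨c, d + 1, fun {n} G => tr n G, fun {n} G => l n G, fun {n} G => hexec n G,
    fun {n} G => hout n G, fun {n G U} => hmem n G U, fun {n} G => ?_⟩
  calc (tr n G).length ≤ (n + (maxConnectedPSets P G).ncard + 2) ^ d := by
        simpa using (hlen n G).trans (hd _)
    _ < (n + (maxConnectedPSets P G).ncard + 2) ^ (d + 1) :=
        Nat.pow_lt_pow_succ (by lia)

namespace Enumerator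

variable {P : GraphClass} {E : Enumerator P} {n B : ℕ} {G : SimpleGraph (Fin n)}
  {L : List (Finset (Fin n))} {K U : Finset (Fin n)} {v : Fin n}

/-- The solutions that the enumerator finds within `B` steps. -/
def found (E : Enumerator P) (G : SimpleGraph (Fin n)) (B : ℕ) : List (Finset (Fin n)) :=
  (E.solutions G).take (Trace.outputs ((E.trace G).take B)).length

theorem map_found (G : SimpleGraph (Fin n)) (B : ℕ) :
    (E.found G B).map encodeVertexSet = Trace.outputs ((E.trace G).take B) := by
  have h := Trace.outputs_take_prefix_outputs (E.trace G) B
  rw [found, List.map_take, ← E.outputs_trace, ← List.prefix_iff_eq_take.1 h]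

theorem mem_of_mem_found (h : U ∈ E.found G B) : U ∈ maxConnectedPSets P G :=
  E.mem_solutions.1 (List.mem_of_mem_take h)

theorem mem_found_of_length_lt (hB : (E.trace G).length < B) (h : U ∈ maxConnectedPSets P G) :
    U ∈ E.found G B := by
  have hlen := congrArg List.length (E.outputs_trace G)
  rw [List.length_map] at hlen
  rwa [found, List.take_of_length_le hB.le, hlen, List.take_length, E.mem_solutions]

theorem length_trace_lt_of_ncard_le {k : ℕ} (hB : (n + k + 2) ^ E.deg ≤ B)
    (h : (maxConnectedPSets P G).ncard ≤ k) : (E.trace G).length < B :=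
  (E.length_trace_lt G).trans_le ((Nat.pow_le_pow_left (by lia) _).trans hB)

/-- Clocked test for `HasUncovered P G L K`: the enumerator is run for `B` steps, and a run that
does not halt is evidence that there are more solutions than the members of `L` cover. -/
def Uncovers (E : Enumerator P) (G : SimpleGraph (Fin n)) (B : ℕ) (L : List (Finset (Fin n)))
    (K : Finset (Fin n)) : Prop :=
  (∃ X ∈ E.found (edgesWithin G K) B, X ⊆ K ∧ ∀ U ∈ L, ¬ X ⊆ U) ∨
    ¬ (E.trace (edgesWithin G K)).length < B

theorem uncovers_iff (hP : P.Hereditary) (hB : (n + (L.length + n) + 2) ^ E.deg ≤ B)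
    (hL : ∀ U ∈ L, IsConnectedPSet P G U) (hU : U ∈ ∅ :: L) (hK : K ⊆ insert v U) :
    E.Uncovers G B L K ↔ HasUncovered P G L K := by
  constructor
  · rintro (⟨X, hX, hXK, hXL⟩ | hlong)
    · have hc : IsConnectedPSet P (edgesWithin G K) X :=
        (show Maximal _ X from mem_of_mem_found hX).prop
      rw [IsConnectedPSet, induce_edgesWithin hXK] at hc
      exact ⟨X, hc, hXK, hXL⟩
    · contrapose! hlong
      exact length_trace_lt_of_ncard_le hB
        (ncard_maxConnectedPSets_edgesWithin_le hP hL hU hK hlong)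
  · rintro ⟨X, hX, hXK, hXL⟩
    refine or_iff_not_imp_right.2 fun hshort => ?_
    obtain ⟨Y, hXY, hY⟩ := (Set.toFinite {Y | IsConnectedPSet P (edgesWithin G K) Y}
      ).exists_le_maximal ((isConnectedPSet_edgesWithin hP).2 (.inl ⟨hX, hXK⟩))
    refine ⟨Y, mem_found_of_length_lt (not_not.1 hshort) hY, ?_,
      fun U hU hYU => hXL U hU (hXY.trans hYU)⟩
    rcases (isConnectedPSet_edgesWithin hP).1 hY.prop with ⟨-, hYK⟩ | ⟨x, rfl⟩
    · exact hYK
    · rwa [← hX.nonempty.subset_singleton_iff.1 hXY]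

/-- Clocked test for `IsConnectedPSet P G K`: `K` is a solution of the graph with the vertices
outside `K` isolated. It makes up for the lack of a decision procedure for `P`. -/
def Accepts (E : Enumerator P) (G : SimpleGraph (Fin n)) (B : ℕ) (K : Finset (Fin n)) : Prop :=
  K ∈ E.found (edgesWithin G K) B

theorem accepts_iff (hP : P.Hereditary) (hB : (n + (1 + n) + 2) ^ E.deg ≤ B) :
    E.Accepts G B K ↔ IsConnectedPSet P G K := by
  constructor
  · intro h
    have hc : IsConnectedPSet P (edgesWithin G K) K :=
      (show Maximal _ K from mem_of_mem_found h).prop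
    rwa [IsConnectedPSet, induce_edgesWithin subset_rfl] at hc
  · intro h
    obtain ⟨v, -⟩ := h.nonempty
    refine mem_found_of_length_lt (length_trace_lt_of_ncard_le hB
      (ncard_maxConnectedPSets_edgesWithin_le (L := [K]) (U := K) (v := v) hP (by simpa) (by simp)
        (Finset.subset_insert v K) fun ⟨_, _, hXK, hX⟩ => hX K (by simp) hXK))
      ⟨(isConnectedPSet_edgesWithin hP).2 (.inl ⟨h, subset_rfl⟩), fun T hT hKT => ?_⟩
    rcases (isConnectedPSet_edgesWithin hP).1 hT with ⟨-, hTK⟩ | ⟨x, rfl⟩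
    · exact hTK
    · exact (h.nonempty.subset_singleton_iff.1 hKT).ge

open Classical in
/-- `K` with vertices discarded one by one as long as it passes the test `Uncovers`. -/
noncomputable def shrink (E : Enumerator P) (G : SimpleGraph (Fin n)) (B : ℕ)
    (L : List (Finset (Fin n))) (K : Finset (Fin n)) : Finset (Fin n) :=
  greedyErase (E.Uncovers G B L) (List.finRange n) K

theorem shrink_spec (hP : P.Hereditary) (hB : (n + (L.length + n) + 2) ^ E.deg ≤ B)
    (hL : ∀ U ∈ L, IsConnectedPSet P G U) (hU : U ∈ ∅ :: L)
    (h : E.Uncovers G B L (insert v U)) :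
    IsConnectedPSet P G (E.shrink G B L (insert v U)) ∧
      ∀ W ∈ L, ¬ E.shrink G B L (insert v U) ⊆ W := by
  classical
  have hiff (K) (hK : K ⊆ insert v U) := uncovers_iff hP hB hL hU hK
  rw [shrink, greedyErase_congr hiff]
  exact prop_of_minimal_hasUncovered (minimal_greedyErase (fun _ _ hK h => h.mono hK)
    List.mem_finRange ((hiff _ subset_rfl).1 h))

open Classical in
/-- `K` extended by vertices one by one as long as it passes the test `Accepts`. -/
noncomputable def extend (E : Enumerator P) (G : SimpleGraph (Fin n)) (B : ℕ)
    (K : Finset (Fin n)) : Finset (Fin n) :=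
  (greedyInsert (E.Accepts G B) (List.finRange n))^[n] K

theorem subset_extend : K ⊆ E.extend G B K := by
  classical
  exact subset_iterate_greedyInsert n

theorem extend_mem (hP : P.Hereditary) (hB : (n + (1 + n) + 2) ^ E.deg ≤ B)
    (h : IsConnectedPSet P G K) : E.extend G B K ∈ maxConnectedPSets P G := by
  classical
  have haccepts : E.Accepts G B = IsConnectedPSet P G :=
    funext fun _ => propext (accepts_iff hP hB)
  have hinsert : ∀ ⦃C T⦄, IsConnectedPSet P G C → IsConnectedPSet P G T → C ⊂ T →
      ∃ v, v ∉ C ∧ IsConnectedPSet P G (insert v C) := fun C T hC hT hCT =>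
    (hT.exists_insert hP hC hCT).imp fun _ hv => hv.2
  have hmax : Maximal (E.Accepts G B) (E.extend G B K) := by
    rw [← haccepts] at hinsert h
    simpa only [extend, Fintype.card_fin] using
      maximal_iterate_greedyInsert hinsert List.mem_finRange h
  rwa [haccepts] at hmax

/-- The time after which a run within the search for a solution not in `L` is stopped. -/
def budget (E : Enumerator P) (L : List (Finset (Fin n))) : ℕ :=
  (n + (L.length + 1 + n) + 2) ^ E.deg

open Classical in
/-- A solution not in the list `L` of solutions, if there is one. -/
noncomputable def next (E : Enumerator P) (G : SimpleGraph (Fin n)) (L : List (Finset (Fin n))) :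
    Option (Finset (Fin n)) :=
  (∅ :: L).findSome? fun U => (List.finRange n).findSome? fun v =>
    if E.Uncovers G (E.budget L) L (insert v U) then
      some (E.extend G (E.budget L) (E.shrink G (E.budget L) L (insert v U)))
    else none

theorem next_eq_some (hP : P.Hereditary) (hL : ∀ U ∈ L, U ∈ maxConnectedPSets P G)
    (h : E.next G L = some U) : U ∈ maxConnectedPSets P G ∧ U ∉ L := by
  obtain ⟨W, hW, h⟩ := List.exists_of_findSome?_eq_some h
  obtain ⟨v, -, h⟩ := List.exists_of_findSome?_eq_some h
  rw [Option.ite_none_right_eq_some, Option.some_inj] at h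
  obtain ⟨huncovers, rfl⟩ := h
  obtain ⟨hconn, hnew⟩ := shrink_spec hP (Nat.pow_le_pow_left (by lia) _)
    (fun U hU => (show Maximal _ U from hL U hU).prop) hW huncovers
  exact ⟨extend_mem hP (Nat.pow_le_pow_left (by lia) _) hconn,
    fun hmem => hnew _ hmem subset_extend⟩

theorem next_eq_none (hP : P.Hereditary) (hL : ∀ U ∈ L, U ∈ maxConnectedPSets P G)
    (h : E.next G L = none) (hU : U ∈ maxConnectedPSets P G) : U ∈ L := by
  by_contra hUL
  obtain ⟨W, hW, v, huncovered⟩ := exists_hasUncovered_insert hP hL hU hUL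
  have := List.findSome?_eq_none_iff.1 (List.findSome?_eq_none_iff.1 h W hW) v (List.mem_finRange v)
  have huncovers : E.Uncovers G (E.budget L) L (insert v W) :=
    (uncovers_iff hP (Nat.pow_le_pow_left (by lia) _)
      (fun U hU => (show Maximal _ U from hL U hU).prop) hW subset_rfl).2 huncovered
  rw [if_pos huncovers] at this
  exact absurd this (Option.some_ne_none _)

end Enumerator

/-! ### Polynomial-time operations on vertex sets -/

namespace PolyTime

open PolyTimeWith

variable {α : Type*} {m : α → ℕ} {i : α → BTree} {n : α → ℕ} {G : ∀ a, SimpleGraph (Fin (n a))}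
  {K U W : ∀ a, Finset (Fin (n a))} {v : ∀ a, Fin (n a)}

theorem vertexSet_subset (hn : PolyBdd m n) (hU : PolyTime m i fun a => encodeVertexSet (U a))
    (hW : PolyTime m i fun a => encodeVertexSet (W a)) :
    PolyTime m i fun a => .bit (U a ⊆ W a) :=
  (all (fun a => List.finRange (n a)) (fun a x => .cons (.bit (x ∈ U a)) (.bit (x ∈ W a)))
    (fun a x => ¬ x ∈ U a ∨ x ∈ W a) (by simpa using hn)
    (zip _ _ _ (by simpa using hn) (hU.congr fun a => encodeVertexSet_eq _)
      (hW.congr fun a => encodeVertexSet_eq _))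
    (arg.fst.bit_not.bit_or arg.snd)).congr fun a =>
      BTree.bit_inj.2 (by simp [Finset.subset_iff, imp_iff_not_or])

theorem vertexSet_insert (hn : PolyBdd m n) (hK : PolyTime m i fun a => encodeVertexSet (K a))
    (hv : PolyTime m i fun a => encodeVertexSet {v a}) :
    PolyTime m i fun a => encodeVertexSet (insert (v a) (K a)) :=
  (map (fun a => List.finRange (n a))
    (fun a x => .cons (.bit (x ∈ ({v a} : Finset _))) (.bit (x ∈ K a)))
    (fun a x => .bit (x ∈ ({v a} : Finset _) ∨ x ∈ K a)) (by simpa using hn)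
    (zip _ _ _ (by simpa using hn) (hv.congr fun a => encodeVertexSet_eq _)
      (hK.congr fun a => encodeVertexSet_eq _))
    (arg.fst.bit_or arg.snd)).congr fun a => by
      simp only [encodeVertexSet_eq, Finset.mem_insert, Finset.mem_singleton]

theorem vertexSet_erase (hn : PolyBdd m n) (hK : PolyTime m i fun a => encodeVertexSet (K a))
    (hv : PolyTime m i fun a => encodeVertexSet {v a}) :
    PolyTime m i fun a => encodeVertexSet ((K a).erase (v a)) :=
  (map (fun a => List.finRange (n a))
    (fun a x => .cons (.bit (x ∈ ({v a} : Finset _))) (.bit (x ∈ K a)))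
    (fun a x => .bit (¬ x ∈ ({v a} : Finset _) ∧ x ∈ K a)) (by simpa using hn)
    (zip _ _ _ (by simpa using hn) (hv.congr fun a => encodeVertexSet_eq _)
      (hK.congr fun a => encodeVertexSet_eq _))
    (arg.fst.bit_not.bit_and arg.snd)).congr fun a => by
      simp only [encodeVertexSet_eq, Finset.mem_erase, Finset.mem_singleton, ne_eq]

theorem singletons (hn : PolyBdd m n) (hn' : PolyTime m i fun a => .unary (n a)) :
    PolyTime m i fun a => .ofList ((List.finRange (n a)).map fun x => encodeVertexSet {x}) :=
  (idMatrix hn hn').congr fun a => by simp only [encodeVertexSet_eq, Finset.mem_singleton]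

theorem graph_edgesWithin (hn : PolyBdd m n) (hG : PolyTime m i fun a => encodeGraph (G a))
    (hK : PolyTime m i fun a => encodeVertexSet (K a)) :
    PolyTime m i fun a => encodeGraph (edgesWithin (G a) (K a)) := by
  let row (a : α) (x : Fin (n a)) : BTree :=
    .ofList ((List.finRange (n a)).map fun y => .bit ((G a).Adj x y))
  have rows : PolyTime m i fun a => .ofList ((List.finRange (n a)).map (row a)) :=
    hG.congr fun a => encodeGraph_eq _
  have bits : PolyTime m i fun a => .ofList ((List.finRange (n a)).map fun x => .bit (x ∈ K a)) :=
    hK.congr fun a => encodeVertexSet_eq _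
  refine (map (fun a => List.finRange (n a)) (fun a x => .cons (.bit (x ∈ K a)) (row a x))
    (fun a x => .ofList ((List.finRange (n a)).map fun y =>
      .bit ((edgesWithin (G a) (K a)).Adj x y)))
    (by simpa using hn) (zip _ _ _ (by simpa using hn) bits rows) ?_).congr
      fun a => (encodeGraph_eq _).symm
  have hn' : PolyBdd (fun p : Σ a, Fin (n a) => m p.1) fun p => (List.finRange (n p.1)).length := by
    simpa using hn.reindex Sigma.fst
  refine (map (fun p : Σ a, Fin (n a) => List.finRange (n p.1))
    (fun p y => .cons (.bit (y ∈ K p.1)) (.bit ((G p.1).Adj p.2 y)))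
    (fun p y => .bit (p.2 ∈ K p.1 ∧ y ∈ K p.1 ∧ (G p.1).Adj p.2 y)) hn'
    (zip _ _ _ hn' (context.comp (bits.reindex Sigma.fst)) arg.snd)
    (context.fst.fst.bit_and (arg.fst.bit_and arg.snd))).congr fun p => ?_
  simp only [edgesWithin_adj]

end PolyTime

/-! ### The running time of the search -/

/-- A graph together with a list of vertex sets. -/
abbrev SearchState : Type := Σ n, SimpleGraph (Fin n) × List (Finset (Fin n))

namespace Enumerator

open PolyTimeWith

variable {P : GraphClass} (E : Enumerator P)

/-- The number of vertices plus the number of vertex sets. -/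
def size (s : SearchState) : ℕ := s.1 + s.2.2.length

/-- A search state as a tree. The unary budget serves as a clock and the list of singletons allows
loops over all vertices. -/
noncomputable abbrev encodeState (s : SearchState) : BTree :=
  .cons (encodeGraph s.2.1) (.cons (.unary (E.budget s.2.2))
    (.cons (.ofList ((List.finRange s.1).map fun x => encodeVertexSet {x}))
      (.ofList (s.2.2.map encodeVertexSet))))

theorem polyBdd_order {δ : Type*} (φ : δ → SearchState) :
    PolyBdd (fun d => size (φ d)) fun d => (φ d).1 :=
  (PolyBdd.self _).mono fun _ => Nat.le_add_right _ _

theorem polyBdd_finRange {δ : Type*} (φ : δ → SearchState) :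
    PolyBdd (fun d => size (φ d)) fun d => (List.finRange (φ d).1).length := by
  simpa using polyBdd_order φ

theorem polyBdd_known {δ : Type*} (φ : δ → SearchState) :
    PolyBdd (fun d => size (φ d)) fun d => (φ d).2.2.length :=
  (PolyBdd.self _).mono fun _ => Nat.le_add_left _ _

theorem polyBdd_budget {δ : Type*} (φ : δ → SearchState) :
    PolyBdd (fun d => size (φ d)) fun d => E.budget (φ d).2.2 :=
  (((polyBdd_order φ).add (((polyBdd_known φ).add (.const _ 1)).add (polyBdd_order φ))).add
    (.const _ 2)).pow E.deg

theorem polyTime_run : PolyTimeWith size E.encodeState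
    (fun s (K : Finset (Fin s.1)) => encodeVertexSet K) fun s K =>
      .cons (.ofList ((E.found (edgesWithin s.2.1 K) (E.budget s.2.2)).reverse.map encodeVertexSet))
        (.unary (E.budget s.2.2 - (E.trace (edgesWithin s.2.1 K)).length)) :=
  (PolyTime.simulate E.prog (fun p : Σ s : SearchState, Finset (Fin s.1) => E.exec _)
    (E.polyBdd_budget _) (.graph_edgesWithin (polyBdd_order _) context.fst arg)
    context.snd.fst).congr fun p => by
      dsimp only
      rw [List.map_reverse, map_found]

theorem polyBdd_found {δ : Type*} (φ : δ → SearchState) (K : ∀ d, Finset (Fin (φ d).1)) :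
    PolyBdd (fun d => size (φ d)) fun d =>
      (E.found (edgesWithin (φ d).2.1 (K d)) (E.budget (φ d).2.2)).reverse.length :=
  (E.polyBdd_budget φ).mono fun d => by
    rw [List.length_reverse, ← List.length_map encodeVertexSet, map_found]
    exact (List.reduceOption_length_le _).trans (List.length_take_le _ _)

theorem polyTime_uncovers : PolyTimeWith size E.encodeState
    (fun s (K : Finset (Fin s.1)) => encodeVertexSet K) fun s K =>
      .bit (E.Uncovers s.2.1 (E.budget s.2.2) s.2.2 K) := by
  have new : PolyTimeWith (fun p : Σ s : SearchState, Finset (Fin s.1) => size p.1)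
      (fun p => .cons (encodeVertexSet p.2) (E.encodeState p.1)) (fun _ => encodeVertexSet)
      fun p X => .bit (X ⊆ p.2 ∧ ∀ U ∈ p.1.2.2, ¬ X ⊆ U) :=
    (PolyTime.vertexSet_subset (polyBdd_order _) arg context.fst).bit_and
      (.all _ (fun _ => encodeVertexSet) _ (polyBdd_known _) context.snd.snd.snd.snd
        (PolyTime.vertexSet_subset (polyBdd_order _) context.fst arg).bit_not)
  refine ((PolyTime.any _ (fun _ => encodeVertexSet) _ (E.polyBdd_found _ _) E.polyTime_run.fst
    new).bit_or E.polyTime_run.snd.bit_ne_nil.bit_not).congr fun p => BTree.bit_inj.2 ?_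
  simp only [List.mem_reverse, ne_eq, BTree.unary_eq_nil, Nat.sub_eq_zero_iff_le, not_le, Uncovers]

theorem polyTime_accepts : PolyTimeWith size E.encodeState
    (fun s (K : Finset (Fin s.1)) => encodeVertexSet K) fun s K =>
      .bit (E.Accepts s.2.1 (E.budget s.2.2) K) := by
  have eq : PolyTimeWith (fun p : Σ s : SearchState, Finset (Fin s.1) => size p.1)
      (fun p => .cons (encodeVertexSet p.2) (E.encodeState p.1)) (fun _ => encodeVertexSet)
      fun p X => .bit (X ⊆ p.2 ∧ p.2 ⊆ X) :=
    (PolyTime.vertexSet_subset (polyBdd_order _) arg context.fst).bit_and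
      (.vertexSet_subset (polyBdd_order _) context.fst arg)
  refine (PolyTime.any _ (fun _ => encodeVertexSet) _ (E.polyBdd_found _ _) E.polyTime_run.fst
    eq).congr fun p => BTree.bit_inj.2 ?_
  simp only [List.mem_reverse, ← Finset.Subset.antisymm_iff, exists_eq_right, Accepts]

theorem polyTime_shrink : PolyTimeWith size E.encodeState
    (fun s (K : Finset (Fin s.1)) => encodeVertexSet K) fun s K =>
      encodeVertexSet (E.shrink s.2.1 (E.budget s.2.2) s.2.2 K) := by
  classical
  let current (p : Σ q : Σ s : SearchState, Finset (Fin s.1), Finset (Fin q.1.1) × Fin q.1.1) :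
      Σ s : SearchState, Finset (Fin s.1) := ⟨p.1.1, p.2.1.erase p.2.2⟩
  have erase : PolyTime (fun p => size (current p).1)
      (fun p => .cons (.cons (encodeVertexSet {p.2.2}) (encodeVertexSet p.2.1))
        (.cons (encodeVertexSet p.1.2) (E.encodeState p.1.1)))
      fun p => encodeVertexSet (current p).2 :=
    .vertexSet_erase (polyBdd_order _) arg.snd arg.fst
  exact PolyTime.foldl (γ := fun p : Σ s : SearchState, Finset (Fin s.1) => Finset (Fin p.1.1)) _
    (fun _ x => encodeVertexSet {x}) (fun _ => encodeVertexSet) _ _ (polyBdd_finRange _)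
    context.snd.snd.fst arg (((E.polyTime_uncovers.subst current erase context.snd).ite erase
      arg.snd).congr fun p => (apply_ite encodeVertexSet _ _ _).symm)

open Classical in
theorem polyTime_greedyInsert : PolyTimeWith size E.encodeState
    (fun s (K : Finset (Fin s.1)) => encodeVertexSet K) fun s K =>
      encodeVertexSet (greedyInsert (E.Accepts s.2.1 (E.budget s.2.2)) (List.finRange s.1) K) := by
  let current (p : Σ q : Σ s : SearchState, Finset (Fin s.1), Finset (Fin q.1.1) × Fin q.1.1) :
      Σ s : SearchState, Finset (Fin s.1) := ⟨p.1.1, insert p.2.2 p.2.1⟩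
  have insert : PolyTime (fun p => size (current p).1)
      (fun p => .cons (.cons (encodeVertexSet {p.2.2}) (encodeVertexSet p.2.1))
        (.cons (encodeVertexSet p.1.2) (E.encodeState p.1.1)))
      fun p => encodeVertexSet (current p).2 :=
    .vertexSet_insert (polyBdd_order _) arg.snd arg.fst
  exact PolyTime.foldl (γ := fun p : Σ s : SearchState, Finset (Fin s.1) => Finset (Fin p.1.1)) _
    (fun _ x => encodeVertexSet {x}) (fun _ => encodeVertexSet) _ _ (polyBdd_finRange _)
    context.snd.snd.fst arg (((E.polyTime_accepts.subst current insert context.snd).ite insert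
      arg.snd).congr fun p => (apply_ite encodeVertexSet _ _ _).symm)

theorem polyTime_extend : PolyTimeWith size E.encodeState
    (fun s (K : Finset (Fin s.1)) => encodeVertexSet K) fun s K =>
      encodeVertexSet (E.extend s.2.1 (E.budget s.2.2) K) := by
  classical
  let current (p : Σ q : Σ s : SearchState, Finset (Fin s.1), Finset (Fin q.1.1) × Fin q.1.1) :
      Σ s : SearchState, Finset (Fin s.1) := ⟨p.1.1, p.2.1⟩
  refine (PolyTime.foldl (γ := fun p : Σ s : SearchState, Finset (Fin s.1) => Finset (Fin p.1.1))
    (fun p => List.finRange p.1.1) (fun _ x => encodeVertexSet {x}) (fun _ => encodeVertexSet)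
    (fun p K _ => greedyInsert (E.Accepts p.1.2.1 (E.budget p.1.2.2)) (List.finRange p.1.1) K)
    Sigma.snd (polyBdd_finRange _) context.snd.snd.fst arg
    (E.polyTime_greedyInsert.subst current arg.snd context.snd)).congr fun p => ?_
  simp only [List.foldl_const, List.length_finRange, extend]

theorem polyTime_next : PolyTime size E.encodeState fun s =>
    .ofOption encodeVertexSet (E.next s.2.1 s.2.2) := by
  classical
  have empty : PolyTime size E.encodeState fun s => encodeVertexSet (∅ : Finset (Fin s.1)) :=
    (PolyTime.map (fun s : SearchState => List.finRange s.1) (fun _ x => encodeVertexSet {x})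
      (fun _ _ => .bit False) (polyBdd_finRange _) (PolyTime.id _ _).snd.snd.fst
      (PolyTime.nil.congr fun _ => by simp)).congr fun s => by
        simp only [encodeVertexSet_eq, Finset.notMem_empty]
  let current (p : Σ q : Σ s : SearchState, Finset (Fin s.1), Fin q.1.1) :
      Σ s : SearchState, Finset (Fin s.1) := ⟨p.1.1, insert p.2 p.1.2⟩
  have insert : PolyTime (fun p => size (current p).1)
      (fun p => .cons (encodeVertexSet {p.2}) (.cons (encodeVertexSet p.1.2) (E.encodeState p.1.1)))
      fun p => encodeVertexSet (current p).2 :=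
    .vertexSet_insert (polyBdd_order _) context.fst arg
  let shrunk (p : Σ q : Σ s : SearchState, Finset (Fin s.1), Fin q.1.1) :
      Σ s : SearchState, Finset (Fin s.1) :=
    ⟨p.1.1, E.shrink p.1.1.2.1 (E.budget p.1.1.2.2) p.1.1.2.2 (current p).2⟩
  have extended := E.polyTime_extend.subst shrunk
    (E.polyTime_shrink.subst current insert context.snd) context.snd
  exact PolyTime.findSome (δ := fun s : SearchState => Finset (Fin s.1)) (fun s => ∅ :: s.2.2)
    (fun _ => encodeVertexSet) (fun _ => encodeVertexSet) _ ((polyBdd_known _).add (.const _ 1))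
    (empty.cons (PolyTime.id _ _).snd.snd.snd)
    (PolyTime.findSome (δ := fun p : Σ s : SearchState, Finset (Fin s.1) => Finset (Fin p.1.1))
      (fun p => List.finRange p.1.1) (fun _ x => encodeVertexSet {x}) (fun _ => encodeVertexSet) _
      (polyBdd_finRange _) context.snd.snd.fst
      (((E.polyTime_uncovers.subst current insert context.snd).ite (extended.cons .nil)
        .nil).congr fun p => by
          simp only [apply_ite (BTree.ofOption encodeVertexSet), BTree.ofOption_some,
            BTree.ofOption_none, current, shrunk]))

theorem polyTime_encodeState : PolyTime size
    (fun s => .cons (encodeGraph s.2.1) (.ofList (s.2.2.map encodeVertexSet))) E.encodeState := by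
  let i (s : SearchState) : BTree :=
    .cons (encodeGraph s.2.1) (.ofList (s.2.2.map encodeVertexSet))
  have order : PolyTime size i fun s : SearchState => .unary s.1 :=
    .unary_order (polyBdd_order _) arg
  have known : PolyTime size i fun s : SearchState => .unary s.2.2.length :=
    (PolyTime.unary_length (fun s : SearchState => s.2.2.map encodeVertexSet)
      (by simpa using polyBdd_known _) context).congr fun s => by rw [List.length_map]
  have bound : PolyTime size i fun s : SearchState => .unary (s.2.2.length + 1 + s.1) :=
    .unary_add (polyBdd_order _) order (PolyTime.nil.cons known)
  have bound_bdd : PolyBdd size fun s : SearchState => s.2.2.length + 1 + s.1 :=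
    ((polyBdd_known _).add (.const _ 1)).add (polyBdd_order _)
  have budget : PolyTime size i fun s : SearchState => .unary (E.budget s.2.2) :=
    .unary_pow (((polyBdd_order _).add bound_bdd).add (.const _ 2))
      (.unary_add (.const _ 2) (.unary_const 2) (.unary_add bound_bdd bound order)) E.deg
  exact arg.cons (budget.cons ((PolyTime.singletons (polyBdd_order _) order).cons context))

end Enumerator

/-! ### From polynomial total time to incremental polynomial time -/

theorem exists_list_of_next {β : Type*} {S : Set β} (hS : S.Finite) {next : List β → Option β}
    (hsome : ∀ L b, (∀ x ∈ L, x ∈ S) → next L = some b → b ∈ S ∧ b ∉ L)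
    (hnone : ∀ L b, (∀ x ∈ L, x ∈ S) → next L = none → b ∈ S → b ∈ L) :
    ∃ l : List β, l.Nodup ∧ (∀ b, b ∈ l ↔ b ∈ S) ∧ ∀ j, next (l.take j).reverse = l[j]? := by
  by_contra! h
  have unbounded (k : ℕ) : ∃ l : List β, l.length = k ∧ l.Nodup ∧ (∀ x ∈ l, x ∈ S) ∧
      ∀ j < k, next (l.take j).reverse = l[j]? := by
    induction k with
    | zero => exact ⟨[], by simp⟩
    | succ k ih =>
      obtain ⟨l, rfl, hnd, hl, hnext⟩ := ih
      have hl' : ∀ x ∈ l.reverse, x ∈ S := by simpa using hl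
      cases hb : next l.reverse with
      | none =>
        obtain ⟨j, hj⟩ := h l hnd fun b => ⟨hl b, fun hbS => by simpa using hnone _ b hl' hb hbS⟩
        refine absurd ?_ hj
        rcases lt_or_ge j l.length with hjl | hjl
        · exact hnext j hjl
        · rw [List.take_of_length_le hjl, hb, List.getElem?_eq_none hjl]
      | some b =>
        obtain ⟨hbS, hbl⟩ := hsome _ b hl' hb
        refine ⟨l ++ [b], by simp, by simpa using hnd.concat (by simpa using hbl),
          by simpa [or_imp, forall_and] using ⟨hl, hbS⟩, fun j hj => ?_⟩
        rcases (Nat.lt_succ_iff.1 hj).lt_or_eq with hjl | rfl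
        · rw [List.take_append_of_le_length hjl.le, List.getElem?_append_left hjl, hnext j hjl]
        · simpa using hb
  obtain ⟨l, hlen, hnd, hl, -⟩ := unbounded (S.ncard + 1)
  have := length_eq_ncard_of_nodup hnd (S := {x | x ∈ l}) fun _ => Iff.rfl
  have := Set.ncard_le_ncard (s := {x | x ∈ l}) hl hS
  lia

theorem Enumerator.incrementallyEnumerable {P : GraphClass} (E : Enumerator P)
    (l : ∀ a : Σ n, SimpleGraph (Fin n), List (Finset (Fin a.1)))
    (hl : ∀ a j, E.next a.2 ((l a).take j).reverse = (l a)[j]?) :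
    IncrementallyEnumerable Sigma.fst (fun a => encodeGraph a.2)
      fun a => (l a).map encodeVertexSet := by
  let state (p : (Σ n, SimpleGraph (Fin n)) × ℕ) : SearchState :=
    ⟨p.1.1, p.1.2, ((l p.1).take p.2).reverse⟩
  have size_state : PolyBdd (fun p => p.1.1 + p.2) fun p => size (state p) :=
    (PolyBdd.self _).mono fun p => by simp [size, state]
  refine PolyTime.incrementallyEnumerable
    (((((polyTime_encodeState E).comp E.polyTime_next).reindex state).measure
      size_state).congr_left (fun p => ?_) |>.congr fun p => ?_)
  · simp [state]
  · dsimp only [state]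
    rw [hl, List.getElem?_map]
    cases (l p.1)[p.2]? <;> rfl

theorem SolvableInPolyTotalTime.solvableInIncrementalPolyTime {P : GraphClass} (hP : P.Hereditary)
    (h : SolvableInPolyTotalTime P) : SolvableInIncrementalPolyTime P := by
  obtain ⟨E⟩ := h.nonempty_enumerator
  choose l hnd hmem hnext using fun a : Σ n, SimpleGraph (Fin n) =>
    exists_list_of_next (Set.toFinite (maxConnectedPSets P a.2)) (next := E.next a.2)
      (fun _ _ hL h => E.next_eq_some hP hL h) fun _ _ hL h hU => E.next_eq_none hP hL h hU
  obtain ⟨c, d, hc⟩ := E.incrementallyEnumerable l hnext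
  refine ⟨c, (.X 0 + .X 1 + .C 2) ^ d, fun n G => ?_⟩
  obtain ⟨t, hexec, hout, -, hinc⟩ := hc ⟨n, G⟩
  refine ⟨t, enumeratesOn_iff.2 ⟨hexec, l ⟨n, G⟩, hnd ⟨n, G⟩, hmem ⟨n, G⟩, hout⟩, fun s _ hs => ?_⟩
  simpa using hinc s (by simpa [length_eq_ncard_of_nodup (hnd ⟨n, G⟩) (hmem ⟨n, G⟩)] using hs)

theorem mainTheorem3 (P : GraphClass) (hP : P.Hereditary) :
    SolvableInPolyTotalTime P ↔ SolvableInIncrementalPolyTime P :=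
  ⟨fun h => h.solvableInIncrementalPolyTime hP, fun h => h.solvableInPolyTotalTime⟩
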